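/- For $\theta\in(0,\pi/2)$ let $$\mathsf{Gui}(\theta)=\Big\{(r,z)\in\mathbb R^2:\ r>0,\ -\tfrac{\pi}{\sin\theta}<z,\ \max(0,z\tan\theta)<r<z\tan\theta+\tfrac{\pi}{\cos\theta}\Big\},\qquad \mathsf{Lay}(\theta)=\mathsf{Gui}(\theta)\times\mathbb S^1 ,$$ where $\mathsf{Lay}(\theta)$ carries the cylindrical coordinates $(r,z,\phi)$. For a constant $\omega\in(0,1/2]$ let $Q_{\omega,\theta}$ be the closure in $L^2(\mathsf{Lay}(\theta);r\,dr\,dz\,d\phi)$ of the quadratic form $$u\mapsto\int_{\mathsf{Lay}(\theta)}\Big(|\partial_r u|^2+|\partial_z u|^2+\frac{|i\partial_\phi u-\omega u|^2}{r^2}\Big)\,r\,dr\,dz\,d\phi,\qquad u\in C_0^\infty(\mathsf{Lay}(\theta)).$$ Let $(\pi^{[0]}u)(r,z)=(2\pi)^{-1/2}\int_0^{2\pi}u(r,z,\phi)\,d\phi$, and let $\mathsf F_{\omega,\theta}$ be the self-adjoint operator in $L^2(\mathsf{Gui}(\theta);r\,dr\,dz)$ associated with the closed non-negative quadratic form $$\mathfrak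 f_{\omega,\theta}[u]=\int_{\mathsf{Gui}(\theta)}\Big(|\partial_r u|^2+|\partial_z u|^2+\frac{\omega^2}{r^2}|u|^2\Big)\,r\,dr\,dz,\qquad \mathrm{dom}\,\mathfrak f_{\omega,\theta}=\pi^{[0]}(\mathrm{dom}\,Q_{\omega,\theta}),$$ where $\partial_r u,\partial_z u$ are weak derivatives. For $k\in\{1,2,\dots\}$ the $k$-th Rayleigh quotient of $\mathsf F_{\omega,\theta}$ is $$E_k(\mathsf F_{\omega,\theta})=\sup_{u_1,\dots,u_{k-1}\in\mathrm{dom}\,\mathfrak f_{\omega,\theta}}\ \inf_{\substack{u\in\mathrm{dom}\,\mathfrak f_{\omega,\theta}\setminus\{0\}\\ u\perp u_1,\dots,u_{k-1}}}\ \frac{\mathfrak f_{\omega,\theta}[u]}{\|u\|^2_{L^2(\mathsf{Gui}(\theta);r\,dr\,dz)}} .$$ Let $0<\theta_1\le\theta_2<\pi/2$, $\omega_1\in(0,1/2]$ and $\omega_2\in\big[\tfrac{\cos\theta_2}{\cos\theta_1}\,\omega_1,\,1/2\big]$. Then $$E_k(\mathsf F_{\omega_1,\theta_1})\le E_k(\mathsf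 F_{\omega_2,\theta_2})\qquad\text{for all } k\in\{1,2,\dots\}.$$ -/

import Mathlib

open MeasureTheory Filter Topology

noncomputable section

namespace ConicalLayer

/-- The meridian domain `Gui(θ)` of the conical layer; points are pairs `(r, z)`. -/
def Gui (θ : ℝ) : Set (ℝ × ℝ) :=
  {p | 0 < p.1 ∧ -(Real.pi / Real.sin θ) < p.2 ∧ max 0 (p.2 * Real.tan θ) < p.1 ∧
    p.1 < p.2 * Real.tan θ + Real.pi / Real.cos θ}

/-- The measure `r dr dz` on `Gui(θ)`. -/
def guiMeasure (θ : ℝ) : Measure (ℝ × ℝ) :=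
  (volume.restrict (Gui θ)).withDensity (fun p => ENNReal.ofReal p.1)

/-- The measure `r dr dz dφ` on the layer `Lay(θ) = Gui(θ) × 𝕊¹`. The circle is parametrized by
`φ ∈ (0, 2π]`, and points are written `((r, z), φ)`. -/
def layMeasure (θ : ℝ) : Measure ((ℝ × ℝ) × ℝ) :=
  (guiMeasure θ).prod (volume.restrict (Set.Ioc 0 (2 * Real.pi)))

/-- The Hilbert space `L²(Gui(θ); r dr dz)`. -/
abbrev L2Gui (θ : ℝ) : Type := Lp ℂ 2 (guiMeasure θ)

/-- The Hilbert space `L²_cyl(Lay(θ)) = L²(Gui(θ) × 𝕊¹; r dr dz dφ)`. -/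
abbrev L2Lay (θ : ℝ) : Type := Lp ℂ 2 (layMeasure θ)

/-- `C_0^∞(Lay(θ))`: smooth functions of `((r, z), φ)` that are `2π`-periodic in `φ` and vanish
when `(r, z)` is outside some compact subset of `Gui(θ)`. -/
def IsLayTestFunction (θ : ℝ) (u : (ℝ × ℝ) × ℝ → ℂ) : Prop :=
  ContDiff ℝ ((⊤ : ℕ∞) : WithTop ℕ∞) u ∧
  (∀ p φ, u (p, φ + 2 * Real.pi) = u (p, φ)) ∧
  ∃ K : Set (ℝ × ℝ), IsCompact K ∧ K ⊆ Gui θ ∧ ∀ p, p ∉ K → ∀ φ, u (p, φ) = 0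

/-- The magnetic form `‖(i∇ - A_ω) u‖²` for `A_ω = (ω / r) e_φ`, with `ω` constant, on
`C_0^∞(Lay(θ))`, written in cylindrical coordinates. -/
def layForm₀ (ω θ : ℝ) (u : (ℝ × ℝ) × ℝ → ℂ) : ℝ :=
  ∫ x, (‖fderiv ℝ u x ((1, 0), 0)‖ ^ 2 + ‖fderiv ℝ u x ((0, 1), 0)‖ ^ 2 +
    ‖Complex.I * fderiv ℝ u x ((0, 0), 1) - (ω : ℂ) * u x‖ ^ 2 / x.1.1 ^ 2) ∂(layMeasure θ)

/-- The domain of the closure of the form `layForm₀ ω θ` with domain `C_0^∞(Lay(θ))`: those `u` in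
the Hilbert space that are `L²`-limits of a sequence in `C_0^∞(Lay(θ))` which is Cauchy with
respect to the form. -/
def layFormDomain (ω θ : ℝ) : Set (L2Lay θ) :=
  {u | ∃ w : ℕ → (ℝ × ℝ) × ℝ → ℂ, (∀ n, IsLayTestFunction θ (w n)) ∧
    Tendsto (fun n => eLpNorm (fun x => w n x - u x) 2 (layMeasure θ)) atTop (𝓝 0) ∧
    Tendsto (fun p : ℕ × ℕ => layForm₀ ω θ (fun x => w p.1 x - w p.2 x)) atTop (𝓝 0)}

/-- The projection `π^[0]`: the pairing on the circle with `v₀ = (2π)^(-1/2)`. -/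
def axisymmetricProj (u : (ℝ × ℝ) × ℝ → ℂ) (p : ℝ × ℝ) : ℂ :=
  ∫ φ in Set.Ioc 0 (2 * Real.pi), u (p, φ) * ((1 / Real.sqrt (2 * Real.pi) : ℝ) : ℂ)

/-- `g` is the weak derivative of `u` in the direction `v` on the open set `U`. -/
def IsWeakDeriv (U : Set (ℝ × ℝ)) (u g : ℝ × ℝ → ℂ) (v : ℝ × ℝ) : Prop :=
  LocallyIntegrableOn u U ∧ LocallyIntegrableOn g U ∧
  ∀ η : ℝ × ℝ → ℝ, ContDiff ℝ ((⊤ : ℕ∞) : WithTop ℕ∞) η → HasCompactSupport η → tsupport η ⊆ U →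
    ∫ x in U, fderiv ℝ η x v • u x = -∫ x in U, η x • g x

open Classical in
/-- The weak derivative of `u` in the direction `v` on `U` (unique up to null sets), and zero if
there is none. -/
def weakDeriv (U : Set (ℝ × ℝ)) (u : ℝ × ℝ → ℂ) (v : ℝ × ℝ) : ℝ × ℝ → ℂ :=
  if h : ∃ g, IsWeakDeriv U u g v then h.choose else 0

/-- The domain `π^[0](dom Q_{ω,θ})` of the form of the axisymmetric fiber `F_{ω,θ}`. -/
def fiberDomain (ω θ : ℝ) : Set (L2Gui θ) :=
  {g | ∃ u ∈ layFormDomain ω θ, g =ᵐ[guiMeasure θ] axisymmetricProj u}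

/-- The form of the axisymmetric fiber `F_{ω,θ}`:
`∫ (|∂_r u|² + |∂_z u|² + ω² |u|² / r²) r dr dz` over `Gui(θ)`. -/
def fiberForm (ω θ : ℝ) (u : L2Gui θ) : ℝ :=
  ∫ p, (‖weakDeriv (Gui θ) u (1, 0) p‖ ^ 2 + ‖weakDeriv (Gui θ) u (0, 1) p‖ ^ 2 +
    ω ^ 2 / p.1 ^ 2 * ‖u p‖ ^ 2) ∂(guiMeasure θ)

/-- The `k`-th Rayleigh quotient (`k ≥ 1`) of the form `t` with domain `D`, which is by definition
that of the self-adjoint operator associated with the form: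
the supremum over `u₁, …, u_{k-1} ∈ D` of the infimum of `t[u] / ‖u‖²` over nonzero `u ∈ D`
orthogonal to `u₁, …, u_{k-1}`. -/
def rayleighQuotient {H : Type*} [NormedAddCommGroup H] [InnerProductSpace ℂ H]
    (D : Set H) (t : H → ℝ) (k : ℕ) : EReal :=
  ⨆ v : Fin (k - 1) → D,
    ⨅ u ∈ {u : H | u ∈ D ∧ u ≠ 0 ∧ u ∈ (Submodule.span ℂ (Set.range fun i => (v i : H)))ᗮ},
      ((t u / ‖u‖ ^ 2 : ℝ) : EReal)

/-- `E_k(F_{ω,θ})`. -/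
def fiberRayleigh (ω θ : ℝ) (k : ℕ) : EReal :=
  rayleighQuotient (fiberDomain ω θ) (fiberForm ω θ) k

end ConicalLayer

end

noncomputable section

namespace ConicalLayer

/-! ### Smoothness of integrals over a bounded interval depending on a parameter -/

section ParametricIntegral

variable {E F : Type} [NormedAddCommGroup E] [NormedSpace ℝ E] [ProperSpace E]
  [NormedAddCommGroup F] [NormedSpace ℝ F]

/-! Take orthonormal coordinates s = r sin θ + z cos θ along the side of the meridian domain and t =
r cos θ - z sin θ across it. Then r = s sin θ + t cos θ, and `Gui θ` is just {r > 0, 0 < t < π}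
(`mem_Gui_iff`). The diagonal map (s, t) ↦ (s tan θ₁ / tan θ₂, t) multiplies r by cos θ₂ / cos θ₁,
so it carries `Gui θ₁` onto `Gui θ₂`; this is `shear`. It is linear and scales r, hence multiplies
the measure r dr dz by a constant (`exists_map_shear_guiMeasure`).

Pulling a function back multiplies its s-derivative by tan θ₁ / tan θ₂ ≤ 1 and leaves its
t-derivative alone. The potential ω₁² / r² becomes (ω₁ cos θ₂ / cos θ₁)² / r², at most ω₂² / r² in
the new radius. So, after the common Jacobian cancels, pullback does not increase the form quotient
(`guiForm₀_comp_shear_le`). Pullback and composition with the inverse map are adjoint up to a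
constant and preserve the form domains (`IsFormApprox.comp_shear`), so the max-min values compare.

Most of the work lies in reaching test functions. Averaging over the circle and axisymmetric
extension identify the projected domain with the form closure of C_0^∞(Gui) (`mem_fiberDomain_iff`).
Closedness of weak derivatives shows that the stated form is the limit of the forms of approximating
test functions (`IsFormApprox.tendsto_guiForm₀`). -/

theorem hasFDerivAt_setIntegral_Ioc {u : E × ℝ → F} (hu : ContDiff ℝ 1 u) (a b : ℝ) (p : E) :
    HasFDerivAt (fun p => ∫ φ in Set.Ioc a b, u (p, φ))
      (∫ φ in Set.Ioc a b, (fderiv ℝ u (p, φ)).comp (ContinuousLinearMap.inl ℝ E ℝ)) p := by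
  have hc : Continuous fun x => (fderiv ℝ u x).comp (ContinuousLinearMap.inl ℝ E ℝ) :=
    (hu.continuous_fderiv one_ne_zero).clm_comp continuous_const
  obtain ⟨C, hC⟩ := ((isCompact_closedBall p 1).prod
    (isCompact_Icc (a := a) (b := b))).exists_bound_of_continuousOn hc.continuousOn
  have hint : ∀ {G : Type} [NormedAddCommGroup G] (v : E × ℝ → G), Continuous v → ∀ q : E,
      IntegrableOn (fun φ => v (q, φ)) (Set.Ioc a b) := fun v hv q =>
    ((hv.comp (Continuous.prodMk_right q)).continuousOn.integrableOn_compact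
      isCompact_Icc).mono_set Set.Ioc_subset_Icc_self
  refine hasFDerivAt_integral_of_dominated_of_fderiv_le (𝕜 := ℝ) (bound := fun _ => C)
    (F' := fun q φ => (fderiv ℝ u (q, φ)).comp (ContinuousLinearMap.inl ℝ E ℝ))
    (Metric.closedBall_mem_nhds p one_pos)
    (Eventually.of_forall fun q => (hint u hu.continuous q).aestronglyMeasurable)
    (hint u hu.continuous p) (hint _ hc p).aestronglyMeasurable ?_ (integrable_const C) ?_
  · filter_upwards [ae_restrict_mem measurableSet_Ioc] with φ hφ q hq
    exact hC (q, φ) ⟨hq, Set.Ioc_subset_Icc_self hφ⟩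
  · refine Eventually.of_forall fun φ q _ => ?_
    have h1 := (hu.differentiable one_ne_zero (q, φ)).hasFDerivAt
    exact h1.comp q (hasFDerivAt_prodMk_left q φ)

/-- The derivative is an integral of the same kind with values in continuous linear maps, so the
induction has to quantify over the target space. -/
theorem contDiff_nat_setIntegral_Ioc (a b : ℝ) (n : ℕ) :
    ∀ {F : Type} [NormedAddCommGroup F] [NormedSpace ℝ F] {u : E × ℝ → F},
      ContDiff ℝ ((⊤ : ℕ∞) : WithTop ℕ∞) u →
      ContDiff ℝ n fun p => ∫ φ in Set.Ioc a b, u (p, φ) := by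
  induction n with
  | zero =>
    intro F _ _ u hu
    refine contDiff_zero.2 (continuous_iff_continuousAt.2 fun p => ?_)
    exact (hasFDerivAt_setIntegral_Ioc (hu.of_le (by exact_mod_cast le_top)) a b p).continuousAt
  | succ n ih =>
    intro F _ _ u hu
    have h := hasFDerivAt_setIntegral_Ioc (hu.of_le (by exact_mod_cast le_top)) a b
    push_cast
    refine contDiff_succ_iff_fderiv.2 ⟨fun p => (h p).differentiableAt, by simp, ?_⟩
    rw [funext fun p => (h p).fderiv]
    exact ih ((hu.fderiv_right (m := ((⊤ : ℕ∞) : WithTop ℕ∞)) (by simp)).clm_comp contDiff_const)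

theorem contDiff_setIntegral_Ioc (a b : ℝ) {u : E × ℝ → F}
    (hu : ContDiff ℝ ((⊤ : ℕ∞) : WithTop ℕ∞) u) :
    ContDiff ℝ ((⊤ : ℕ∞) : WithTop ℕ∞) fun p => ∫ φ in Set.Ioc a b, u (p, φ) :=
  contDiff_infty.2 fun n => contDiff_nat_setIntegral_Ioc a b n hu

end ParametricIntegral

/-! ### The meridian domain and the weighted measures -/

theorem isOpen_Gui (θ : ℝ) : IsOpen (Gui θ) := by
  simp only [Gui, Set.ofPred_and]
  refine (isOpen_lt (by fun_prop) (by fun_prop)).inter ((isOpen_lt (by fun_prop) (by fun_prop)).inter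
    ((isOpen_lt (by fun_prop) (by fun_prop)).inter (isOpen_lt (by fun_prop) (by fun_prop))))

instance (θ : ℝ) : IsLocallyFiniteMeasure (guiMeasure θ) :=
  IsLocallyFiniteMeasure.withDensity_ofReal (by fun_prop)

instance (θ : ℝ) : SFinite (guiMeasure θ) := by unfold guiMeasure; infer_instance

instance (θ : ℝ) : IsLocallyFiniteMeasure (layMeasure θ) := by unfold layMeasure; infer_instance

/-- The weight r is positive on the domain, so weighted and Lebesgue null sets agree there. -/
theorem restrict_Gui_absolutelyContinuous (θ : ℝ) :
    volume.restrict (Gui θ) ≪ guiMeasure θ := by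
  refine withDensity_absolutelyContinuous' (by fun_prop) ?_
  filter_upwards [ae_restrict_mem (isOpen_Gui θ).measurableSet] with p hp
  simpa using hp.1

theorem guiMeasure_absolutelyContinuous (θ : ℝ) :
    guiMeasure θ ≪ volume.restrict (Gui θ) :=
  withDensity_absolutelyContinuous _ _

theorem integral_guiMeasure {E : Type*} [NormedAddCommGroup E] [NormedSpace ℝ E]
    (θ : ℝ) (f : ℝ × ℝ → E) :
    ∫ p, f p ∂guiMeasure θ = ∫ p in Gui θ, p.1 • f p := by
  rw [guiMeasure, integral_withDensity_eq_integral_toReal_smul (by fun_prop) (by simp)]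
  refine setIntegral_congr_fun (isOpen_Gui θ).measurableSet fun p hp => ?_
  simp [ENNReal.toReal_ofReal hp.1.le]

theorem integrable_guiMeasure_of_continuousOn {E : Type*} [NormedAddCommGroup E] {θ : ℝ}
    {K : Set (ℝ × ℝ)} (hK : IsCompact K) {f : ℝ × ℝ → E} (hf : ContinuousOn f K)
    (h0 : ∀ p, p ∉ K → f p = 0) : Integrable f (guiMeasure θ) :=
  (hf.integrableOn_compact hK).integrable_of_forall_notMem_eq_zero h0

theorem memLp_guiMeasure_of_continuousOn {θ : ℝ}
    {K : Set (ℝ × ℝ)} (hK : IsCompact K) {f : ℝ × ℝ → ℂ} (hf : ContinuousOn f K)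
    (h0 : ∀ p, p ∉ K → f p = 0) : MemLp f 2 (guiMeasure θ) :=
  (memLp_two_iff_integrable_sq_norm
    (integrable_guiMeasure_of_continuousOn hK hf h0).aestronglyMeasurable).2
    (integrable_guiMeasure_of_continuousOn hK (hf.norm.pow 2) fun p hp => by simp [h0 p hp])

/-- The support is not compact in the lifted angle, but the measure only sees φ ∈ (0, 2π], which
leaves a compact product. -/
theorem integrable_layMeasure_of_continuousOn {E : Type*} [NormedAddCommGroup E] {θ : ℝ}
    {K : Set (ℝ × ℝ)} (hK : IsCompact K) {f : (ℝ × ℝ) × ℝ → E}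
    (hf : ContinuousOn f (K ×ˢ Set.univ)) (h0 : ∀ p, p ∉ K → ∀ φ, f (p, φ) = 0) :
    Integrable f (layMeasure θ) := by
  have h1 : IntegrableOn f (K ×ˢ Set.Icc 0 (2 * Real.pi)) (layMeasure θ) :=
    (hf.mono (Set.prod_mono_right (Set.subset_univ _))).integrableOn_compact (hK.prod isCompact_Icc)
  refine h1.integrable_of_ae_notMem_eq_zero ?_
  have h2 : ∀ᵐ x ∂layMeasure θ, x.2 ∈ Set.Ioc 0 (2 * Real.pi) :=
    Measure.quasiMeasurePreserving_snd.ae (ae_restrict_mem measurableSet_Ioc)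
  filter_upwards [h2] with x hx hxK
  by_cases hp : x.1 ∈ K
  · exact absurd ⟨hp, Set.Ioc_subset_Icc_self hx⟩ hxK
  · exact h0 _ hp _

/-! ### Test functions and the components of the forms -/

/-- `C_0^∞(Gui(θ))`. -/
def IsGuiTestFunction (θ : ℝ) (w : ℝ × ℝ → ℂ) : Prop :=
  ContDiff ℝ ((⊤ : ℕ∞) : WithTop ℕ∞) w ∧
  ∃ K : Set (ℝ × ℝ), IsCompact K ∧ K ⊆ Gui θ ∧ ∀ p, p ∉ K → w p = 0

/-- The three components `∂_r w`, `∂_z w`, `(ω / r) w` whose squared `L²` norms add up to the form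
of the axisymmetric fiber. -/
def guiComponent (ω : ℝ) (w : ℝ × ℝ → ℂ) : Fin 3 → ℝ × ℝ → ℂ :=
  ![fun p => fderiv ℝ w p (1, 0), fun p => fderiv ℝ w p (0, 1), fun p => ((ω / p.1 : ℝ) : ℂ) * w p]

/-- The form of the axisymmetric fiber on `C_0^∞(Gui(θ))`. -/
def guiForm₀ (ω θ : ℝ) (w : ℝ × ℝ → ℂ) : ℝ :=
  ∫ p, ∑ i, ‖guiComponent ω w i p‖ ^ 2 ∂guiMeasure θ

/-- The three components of the magnetic gradient on the layer. -/
def layComponent (ω : ℝ) (u : (ℝ × ℝ) × ℝ → ℂ) : Fin 3 → (ℝ × ℝ) × ℝ → ℂ :=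
  ![fun x => fderiv ℝ u x ((1, 0), 0), fun x => fderiv ℝ u x ((0, 1), 0),
    fun x => ((x.1.1⁻¹ : ℝ) : ℂ) * ((ω : ℂ) * u x - Complex.I * fderiv ℝ u x ((0, 0), 1))]

/-- The angular component has the sign opposite to the original form, which the norm ignores; with
this sign its circle average is exactly the term (ω / r) w. -/
theorem layForm₀_eq (ω θ : ℝ) (u : (ℝ × ℝ) × ℝ → ℂ) :
    layForm₀ ω θ u = ∫ x, ∑ i, ‖layComponent ω u i x‖ ^ 2 ∂layMeasure θ := by
  refine integral_congr_ae (Eventually.of_forall fun x => ?_)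
  simp only [Fin.sum_univ_three, layComponent, Matrix.cons_val, norm_mul, Complex.norm_real,
    mul_pow, norm_inv, inv_pow, Real.norm_eq_abs, sq_abs]
  rw [norm_sub_rev, div_eq_inv_mul]

theorem IsGuiTestFunction.sub {θ : ℝ} {w w' : ℝ × ℝ → ℂ} (hw : IsGuiTestFunction θ w)
    (hw' : IsGuiTestFunction θ w') : IsGuiTestFunction θ (fun p => w p - w' p) := by
  obtain ⟨h, K, hK, hKG, h0⟩ := hw
  obtain ⟨h', K', hK', hKG', h0'⟩ := hw'
  refine ⟨h.sub h', K ∪ K', hK.union hK', Set.union_subset hKG hKG', fun p hp => ?_⟩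
  simp only [Set.mem_union, not_or] at hp
  simp [h0 p hp.1, h0' p hp.2]

theorem IsLayTestFunction.sub {θ : ℝ} {w w' : (ℝ × ℝ) × ℝ → ℂ} (hw : IsLayTestFunction θ w)
    (hw' : IsLayTestFunction θ w') : IsLayTestFunction θ (fun x => w x - w' x) := by
  obtain ⟨h, hper, K, hK, hKG, h0⟩ := hw
  obtain ⟨h', hper', K', hK', hKG', h0'⟩ := hw'
  refine ⟨h.sub h', fun p φ => by simp only [hper, hper'], K ∪ K', hK.union hK',
    Set.union_subset hKG hKG', fun p hp φ => ?_⟩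
  simp only [Set.mem_union, not_or] at hp
  simp [h0 p hp.1, h0' p hp.2]

theorem fderiv_eq_zero_of_compl {E : Type*} [NormedAddCommGroup E] [NormedSpace ℝ E]
    {w : E → ℂ} {K : Set E} (hK : IsClosed K) (h0 : ∀ p, p ∉ K → w p = 0) {p : E} (hp : p ∉ K) :
    fderiv ℝ w p = 0 := by
  have h : w =ᶠ[𝓝 p] fun _ => 0 := by
    filter_upwards [hK.isOpen_compl.mem_nhds hp] with q hq using h0 q hq
  rw [h.fderiv_eq, fderiv_fun_const, Pi.zero_apply]

theorem IsGuiTestFunction.continuous_fderiv {θ : ℝ} {w : ℝ × ℝ → ℂ}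
    (hw : IsGuiTestFunction θ w) (v : ℝ × ℝ) : Continuous fun p => fderiv ℝ w p v :=
  (hw.1.continuous_fderiv (by simp)).clm_apply continuous_const

theorem IsGuiTestFunction.exists_compact {θ : ℝ} {w : ℝ × ℝ → ℂ} (hw : IsGuiTestFunction θ w)
    (ω : ℝ) : ∃ K : Set (ℝ × ℝ), IsCompact K ∧ K ⊆ Gui θ ∧ (∀ p, p ∉ K → w p = 0) ∧
      ∀ i, ContinuousOn (guiComponent ω w i) K ∧ ∀ p, p ∉ K → guiComponent ω w i p = 0 := by
  obtain ⟨K, hK, hKG, h0⟩ := hw.2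
  refine ⟨K, hK, hKG, h0, fun i => ?_⟩
  fin_cases i
  · exact ⟨(hw.continuous_fderiv _).continuousOn, fun p hp => by
      simp [guiComponent, fderiv_eq_zero_of_compl hK.isClosed h0 hp]⟩
  · exact ⟨(hw.continuous_fderiv _).continuousOn, fun p hp => by
      simp [guiComponent, fderiv_eq_zero_of_compl hK.isClosed h0 hp]⟩
  · refine ⟨?_, fun p hp => by simp [guiComponent, h0 p hp]⟩
    refine ContinuousOn.mul (Complex.continuous_ofReal.comp_continuousOn ?_)
      hw.1.continuous.continuousOn
    exact continuousOn_const.div continuousOn_fst fun p hp => (hKG hp).1.ne'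

theorem IsGuiTestFunction.memLp {θ : ℝ} {w : ℝ × ℝ → ℂ} (hw : IsGuiTestFunction θ w) :
    MemLp w 2 (guiMeasure θ) := by
  obtain ⟨K, hK, hKG, h0⟩ := hw.2
  exact memLp_guiMeasure_of_continuousOn hK hw.1.continuous.continuousOn h0

theorem IsGuiTestFunction.memLp_guiComponent {θ : ℝ} {w : ℝ × ℝ → ℂ}
    (hw : IsGuiTestFunction θ w) (ω : ℝ) (i : Fin 3) :
    MemLp (guiComponent ω w i) 2 (guiMeasure θ) := by
  obtain ⟨K, hK, hKG, -, h⟩ := hw.exists_compact ω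
  exact memLp_guiMeasure_of_continuousOn hK (h i).1 (h i).2

theorem IsGuiTestFunction.integrable_form {θ : ℝ} {w : ℝ × ℝ → ℂ}
    (hw : IsGuiTestFunction θ w) (ω : ℝ) :
    Integrable (fun p => ∑ i, ‖guiComponent ω w i p‖ ^ 2) (guiMeasure θ) :=
  integrable_finsetSum _ fun i _ => (hw.memLp_guiComponent ω i).integrable_norm_pow two_ne_zero

theorem guiComponent_sub {ω : ℝ} {w w' : ℝ × ℝ → ℂ} (hw : Differentiable ℝ w)
    (hw' : Differentiable ℝ w') (i : Fin 3) :
    guiComponent ω (fun p => w p - w' p) i = fun p => guiComponent ω w i p - guiComponent ω w' i p := by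
  ext p
  fin_cases i <;> simp [guiComponent, fderiv_fun_sub (hw p) (hw' p), mul_sub]

theorem IsGuiTestFunction.differentiable {θ : ℝ} {w : ℝ × ℝ → ℂ}
    (hw : IsGuiTestFunction θ w) : Differentiable ℝ w := hw.1.differentiable (by simp)

theorem IsLayTestFunction.differentiable {θ : ℝ} {w : (ℝ × ℝ) × ℝ → ℂ}
    (hw : IsLayTestFunction θ w) : Differentiable ℝ w := hw.1.differentiable (by simp)

theorem IsLayTestFunction.exists_compact {θ : ℝ} {w : (ℝ × ℝ) × ℝ → ℂ}
    (hw : IsLayTestFunction θ w) (ω : ℝ) :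
    ∃ K : Set (ℝ × ℝ), IsCompact K ∧ K ⊆ Gui θ ∧ (∀ p, p ∉ K → ∀ φ, w (p, φ) = 0) ∧
      ∀ i, ContinuousOn (layComponent ω w i) (K ×ˢ Set.univ) ∧
        ∀ p, p ∉ K → ∀ φ, layComponent ω w i (p, φ) = 0 := by
  obtain ⟨K, hK, hKG, h0⟩ := hw.2.2
  have hc : ∀ v, Continuous fun x => fderiv ℝ w x v := fun v =>
    (hw.1.continuous_fderiv (by simp)).clm_apply continuous_const
  have hd : ∀ p, p ∉ K → ∀ φ, fderiv ℝ w (p, φ) = 0 := fun p hp φ =>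
    fderiv_eq_zero_of_compl (K := Prod.fst ⁻¹' K) (hK.isClosed.preimage continuous_fst)
      (fun x hx => h0 x.1 hx x.2) hp
  refine ⟨K, hK, hKG, h0, fun i => ?_⟩
  fin_cases i
  · exact ⟨(hc _).continuousOn, fun p hp φ => by simp [layComponent, hd p hp φ]⟩
  · exact ⟨(hc _).continuousOn, fun p hp φ => by simp [layComponent, hd p hp φ]⟩
  · refine ⟨?_, fun p hp φ => by simp [layComponent, hd p hp φ, h0 p hp φ]⟩
    refine ContinuousOn.mul (Complex.continuous_ofReal.comp_continuousOn ?_)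
      ((continuous_const.mul hw.1.continuous).sub (continuous_const.mul (hc _))).continuousOn
    -- The factor 1 / r is singular only on the axis, which the compact set avoids.
    exact (by fun_prop : Continuous fun x : (ℝ × ℝ) × ℝ => x.1.1).continuousOn.inv₀
      fun x hx => (hKG hx.1).1.ne'

theorem IsLayTestFunction.integrable_norm_sq {θ : ℝ} {w : (ℝ × ℝ) × ℝ → ℂ}
    (hw : IsLayTestFunction θ w) (ω : ℝ) (i : Fin 3) :
    Integrable (fun x => ‖layComponent ω w i x‖ ^ 2) (layMeasure θ) := by
  obtain ⟨K, hK, -, -, h⟩ := hw.exists_compact ω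
  exact integrable_layMeasure_of_continuousOn hK ((h i).1.norm.pow 2)
    fun p hp φ => by simp [(h i).2 p hp φ]

/-! ### Averaging over the circle -/

theorem axisymmetricProj_eq (u : (ℝ × ℝ) × ℝ → ℂ) (p : ℝ × ℝ) :
    axisymmetricProj u p =
      (∫ φ in Set.Ioc 0 (2 * Real.pi), u (p, φ)) * ((1 / Real.sqrt (2 * Real.pi) : ℝ) : ℂ) := by
  rw [axisymmetricProj, integral_mul_const]

/-- Cauchy–Schwarz against the unit constant function (2π)^(-1/2) on the circle. -/
theorem enorm_setIntegral_mul_sq_le {h : ℝ → ℂ}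
    (hh : AEStronglyMeasurable h (volume.restrict (Set.Ioc 0 (2 * Real.pi)))) :
    ‖∫ φ in Set.Ioc 0 (2 * Real.pi), h φ * ((1 / Real.sqrt (2 * Real.pi) : ℝ) : ℂ)‖ₑ ^ 2 ≤
      ∫⁻ φ in Set.Ioc 0 (2 * Real.pi), ‖h φ‖ₑ ^ 2 := by
  set ν := volume.restrict (Set.Ioc 0 (2 * Real.pi)) with hν
  have hpi : 0 < 2 * Real.pi := by positivity
  have h1 : (∫⁻ φ, ‖h φ‖ₑ ∂ν) ^ 2 ≤ (∫⁻ φ, ‖h φ‖ₑ ^ 2 ∂ν) * ENNReal.ofReal (2 * Real.pi) := by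
    have := eLpNorm_le_eLpNorm_mul_rpow_measure_univ (p := 1) (q := 2) (by norm_num) hh
    rw [eLpNorm_one_eq_lintegral_enorm, eLpNorm_eq_lintegral_rpow_enorm_toReal (by simp) (by simp),
      hν, Measure.restrict_apply_univ, Real.volume_Ioc, sub_zero, ← hν] at this
    refine (pow_le_pow_left' this 2).trans_eq ?_
    rw [mul_pow, ← ENNReal.rpow_natCast, ← ENNReal.rpow_mul, ← ENNReal.rpow_natCast,
      ← ENNReal.rpow_mul]
    norm_num
  rw [integral_mul_const, enorm_mul, mul_pow]
  have h2 : ‖((1 / Real.sqrt (2 * Real.pi) : ℝ) : ℂ)‖ₑ ^ 2 = (ENNReal.ofReal (2 * Real.pi))⁻¹ := by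
    rw [← ofReal_norm, ← ENNReal.ofReal_pow (norm_nonneg _), Complex.norm_real,
      ← ENNReal.ofReal_inv_of_pos hpi]
    congr 1
    rw [Real.norm_eq_abs, sq_abs, div_pow, Real.sq_sqrt hpi.le, one_pow, one_div]
  rw [h2]
  calc _ ≤ ((∫⁻ φ, ‖h φ‖ₑ ^ 2 ∂ν) * ENNReal.ofReal (2 * Real.pi)) * (ENNReal.ofReal (2 * Real.pi))⁻¹ := by
        gcongr
        exact (pow_le_pow_left' (enorm_integral_le_lintegral_enorm _) 2).trans h1
    _ = _ := by
        rw [mul_assoc, ENNReal.mul_inv_cancel (by simpa using hpi) ENNReal.ofReal_ne_top, mul_one]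

theorem norm_setIntegral_mul_sq_le {h : ℝ → ℂ}
    (hh : MemLp h 2 (volume.restrict (Set.Ioc 0 (2 * Real.pi)))) :
    ‖∫ φ in Set.Ioc 0 (2 * Real.pi), h φ * ((1 / Real.sqrt (2 * Real.pi) : ℝ) : ℂ)‖ ^ 2 ≤
      ∫ φ in Set.Ioc 0 (2 * Real.pi), ‖h φ‖ ^ 2 := by
  have h1 := enorm_setIntegral_mul_sq_le hh.1
  rw [← ENNReal.ofReal_le_ofReal_iff (by positivity),
    ofReal_integral_eq_lintegral_ofReal (hh.integrable_norm_pow two_ne_zero)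
      (Eventually.of_forall fun _ => by positivity), ENNReal.ofReal_pow (norm_nonneg _),
    ofReal_norm]
  refine h1.trans_eq (lintegral_congr fun φ => ?_)
  rw [ENNReal.ofReal_pow (norm_nonneg _), ofReal_norm]

theorem IsLayTestFunction.axisymmetricProj {θ : ℝ} {w : (ℝ × ℝ) × ℝ → ℂ}
    (hw : IsLayTestFunction θ w) : IsGuiTestFunction θ (axisymmetricProj w) := by
  obtain ⟨K, hK, hKG, h0⟩ := hw.2.2
  refine ⟨?_, K, hK, hKG, fun p hp => by simp [ConicalLayer.axisymmetricProj, h0 p hp]⟩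
  rw [funext (axisymmetricProj_eq w)]
  exact (contDiff_setIntegral_Ioc _ _ hw.1).mul contDiff_const

theorem fderiv_axisymmetricProj {w : (ℝ × ℝ) × ℝ → ℂ} (hw : ContDiff ℝ 1 w) (p v : ℝ × ℝ) :
    fderiv ℝ (axisymmetricProj w) p v =
      axisymmetricProj (fun x => fderiv ℝ w x (v, 0)) p := by
  have h := hasFDerivAt_setIntegral_Ioc hw 0 (2 * Real.pi) p
  have hc : Continuous fun φ => (fderiv ℝ w (p, φ)).comp (ContinuousLinearMap.inl ℝ (ℝ × ℝ) ℝ) :=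
    ((hw.continuous_fderiv one_ne_zero).comp (Continuous.prodMk_right p)).clm_comp continuous_const
  rw [funext (axisymmetricProj_eq w), axisymmetricProj_eq,
    (h.mul_const ((1 / Real.sqrt (2 * Real.pi) : ℝ) : ℂ)).fderiv]
  have hi : IntegrableOn (fun φ => (fderiv ℝ w (p, φ)).comp (ContinuousLinearMap.inl ℝ (ℝ × ℝ) ℝ))
      (Set.Ioc 0 (2 * Real.pi)) :=
    (hc.continuousOn.integrableOn_compact isCompact_Icc).mono_set Set.Ioc_subset_Icc_self
  have := ContinuousLinearMap.integral_apply hi v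
  simp only [ContinuousLinearMap.comp_apply, ContinuousLinearMap.inl_apply] at this
  rw [← this]
  simp [mul_comm]

/-- Periodicity makes the boundary terms cancel. -/
theorem setIntegral_fderiv_angle {θ : ℝ} {w : (ℝ × ℝ) × ℝ → ℂ} (hw : IsLayTestFunction θ w)
    (p : ℝ × ℝ) : ∫ φ in Set.Ioc 0 (2 * Real.pi), fderiv ℝ w (p, φ) ((0, 0), 1) = 0 := by
  have hc : Continuous fun φ => fderiv ℝ w (p, φ) ((0, 0), 1) :=
    ((hw.1.continuous_fderiv (by simp)).comp (Continuous.prodMk_right p)).clm_apply continuous_const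
  rw [← intervalIntegral.integral_of_le (by positivity),
    intervalIntegral.integral_eq_sub_of_hasDerivAt (f := fun φ => w (p, φ)) (fun φ _ => ?_)
      (hc.intervalIntegrable _ _)]
  · have := hw.2.1 p 0
    rw [zero_add] at this
    rw [this, sub_self]
  · have h1 := (hw.differentiable (p, φ)).hasFDerivAt
    exact h1.comp_hasDerivAt φ ((hasDerivAt_const φ p).prodMk (hasDerivAt_id φ))

/-- Averaging commutes with the meridian derivatives and kills the angular derivative, leaving only
ω / r from the magnetic term. -/
theorem guiComponent_axisymmetricProj {θ : ℝ} {w : (ℝ × ℝ) × ℝ → ℂ}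
    (hw : IsLayTestFunction θ w) (ω : ℝ) (i : Fin 3) (p : ℝ × ℝ) :
    guiComponent ω (axisymmetricProj w) i p = axisymmetricProj (layComponent ω w i) p := by
  have h1 : ContDiff ℝ 1 w := hw.1.of_le (by exact_mod_cast le_top)
  fin_cases i
  · exact fderiv_axisymmetricProj h1 p _
  · exact fderiv_axisymmetricProj h1 p _
  · have hc : Continuous fun φ => fderiv ℝ w (p, φ) ((0, 0), 1) :=
      ((hw.1.continuous_fderiv (by simp)).comp
        (Continuous.prodMk_right p)).clm_apply continuous_const
    have hc' : Continuous fun φ => w (p, φ) := hw.1.continuous.comp (Continuous.prodMk_right p)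
    have hint : ∀ {f : ℝ → ℂ}, Continuous f → IntegrableOn f (Set.Ioc 0 (2 * Real.pi)) :=
      fun hf => (hf.continuousOn.integrableOn_compact isCompact_Icc).mono_set
        Set.Ioc_subset_Icc_self
    simp only [axisymmetricProj_eq, guiComponent, layComponent, Fin.reduceFinMk, Matrix.cons_val]
    rw [integral_const_mul, integral_sub (hint (by fun_prop)) (hint (by fun_prop)),
      integral_const_mul, integral_const_mul, setIntegral_fderiv_angle hw]
    push_cast
    ring

/-- Cauchy–Schwarz on each circle, component by component. Applied to differences, it makes averages
of form-Cauchy sequences form-Cauchy. -/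
theorem guiForm₀_axisymmetricProj_le {θ : ℝ} {w : (ℝ × ℝ) × ℝ → ℂ}
    (hw : IsLayTestFunction θ w) (ω : ℝ) :
    guiForm₀ ω θ (axisymmetricProj w) ≤ layForm₀ ω θ w := by
  have hI : Integrable (fun x => ∑ i, ‖layComponent ω w i x‖ ^ 2) (layMeasure θ) :=
    integrable_finsetSum _ fun i _ => hw.integrable_norm_sq ω i
  rw [layForm₀_eq, guiForm₀, layMeasure, integral_prod _ hI]
  refine integral_mono (hw.axisymmetricProj.integrable_form ω) hI.integral_prod_left fun p => ?_
  obtain ⟨K, hK, hKG, -, h⟩ := hw.exists_compact ω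
  have hm : ∀ i, MemLp (fun φ => layComponent ω w i (p, φ)) 2
      (volume.restrict (Set.Ioc 0 (2 * Real.pi))) := fun i => by
    by_cases hp : p ∈ K
    · have hc : Continuous fun φ => layComponent ω w i (p, φ) :=
        (h i).1.comp_continuous (Continuous.prodMk_right p) fun φ => ⟨hp, trivial⟩
      refine (memLp_two_iff_integrable_sq_norm hc.aestronglyMeasurable).2 ?_
      exact ((hc.norm.pow 2).continuousOn.integrableOn_compact isCompact_Icc).mono_set
        Set.Ioc_subset_Icc_self
    · simp [(h i).2 p hp]
  simp only
  rw [integral_finsetSum _ fun i _ => (hm i).integrable_norm_pow two_ne_zero]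
  refine Finset.sum_le_sum fun i _ => ?_
  rw [guiComponent_axisymmetricProj hw]
  exact norm_setIntegral_mul_sq_le (hm i)

/-! ### The fiber domain as the form closure of meridian test functions -/

/-- `w` is a sequence in `C_0^∞(Gui(θ))` that converges to `g` in `L²` and is Cauchy for the form
of the axisymmetric fiber. -/
structure IsFormApprox (ω θ : ℝ) (w : ℕ → ℝ × ℝ → ℂ) (g : ℝ × ℝ → ℂ) : Prop where
  test : ∀ n, IsGuiTestFunction θ (w n)
  tendsto : Tendsto (fun n => eLpNorm (fun p => w n p - g p) 2 (guiMeasure θ)) atTop (𝓝 0)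
  cauchy : Tendsto (fun m : ℕ × ℕ => guiForm₀ ω θ (fun p => w m.1 p - w m.2 p)) atTop (𝓝 0)

theorem guiForm₀_nonneg (ω θ : ℝ) (w : ℝ × ℝ → ℂ) : 0 ≤ guiForm₀ ω θ w :=
  integral_nonneg fun _ => Finset.sum_nonneg fun _ _ => by positivity

theorem ae_memLp_layMeasure {θ : ℝ} {u : (ℝ × ℝ) × ℝ → ℂ} (hu : MemLp u 2 (layMeasure θ)) :
    ∀ᵐ p ∂guiMeasure θ, MemLp (fun φ => u (p, φ)) 2 (volume.restrict (Set.Ioc 0 (2 * Real.pi))) := by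
  have h1 := hu.integrable_norm_pow two_ne_zero
  have h2 := hu.1
  rw [layMeasure] at h1 h2
  filter_upwards [h1.prod_right_ae, h2.prodMk_left] with p hp hp'
  exact (memLp_two_iff_integrable_sq_norm hp').2 hp

theorem IsLayTestFunction.memLp {θ : ℝ} {w : (ℝ × ℝ) × ℝ → ℂ}
    (hw : IsLayTestFunction θ w) : MemLp w 2 (layMeasure θ) := by
  obtain ⟨K, hK, hKG, h0⟩ := hw.2.2
  have hc := hw.1.continuous
  exact (memLp_two_iff_integrable_sq_norm hc.aestronglyMeasurable).2
    (integrable_layMeasure_of_continuousOn hK (by fun_prop) fun p hp φ => by simp [h0 p hp φ])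

theorem eLpNorm_two_sq {α : Type*} {m : MeasurableSpace α} (μ : Measure α) (f : α → ℂ) :
    eLpNorm f 2 μ ^ 2 = ∫⁻ x, ‖f x‖ₑ ^ 2 ∂μ := by
  rw [eLpNorm_eq_lintegral_rpow_enorm_toReal (by simp) (by simp), ← ENNReal.rpow_natCast,
    ← ENNReal.rpow_mul]
  norm_num

theorem axisymmetricProj_sub_ae {θ : ℝ} {u v : (ℝ × ℝ) × ℝ → ℂ} (hu : MemLp u 2 (layMeasure θ))
    (hv : MemLp v 2 (layMeasure θ)) :
    (fun p => axisymmetricProj u p - axisymmetricProj v p) =ᵐ[guiMeasure θ]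
      axisymmetricProj fun x => u x - v x := by
  filter_upwards [ae_memLp_layMeasure hu, ae_memLp_layMeasure hv] with p hp hp'
  simp only [axisymmetricProj_eq]
  rw [integral_sub (hp.integrable (by norm_num)) (hp'.integrable (by norm_num)), sub_mul]

theorem eLpNorm_axisymmetricProj_le {θ : ℝ} {u : (ℝ × ℝ) × ℝ → ℂ}
    (hu : MemLp u 2 (layMeasure θ)) :
    eLpNorm (axisymmetricProj u) 2 (guiMeasure θ) ≤ eLpNorm u 2 (layMeasure θ) := by
  rw [← ENNReal.pow_le_pow_left_iff two_ne_zero, eLpNorm_two_sq, eLpNorm_two_sq, layMeasure]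
  have hu' := hu.1
  rw [layMeasure] at hu'
  rw [lintegral_prod _ (by fun_prop)]
  refine lintegral_mono_ae ?_
  filter_upwards [ae_memLp_layMeasure hu] with p hp
  exact enorm_setIntegral_mul_sq_le hp.1

theorem exists_isFormApprox_of_mem {ω θ : ℝ} {g : L2Gui θ} (hg : g ∈ fiberDomain ω θ) :
    ∃ w, IsFormApprox ω θ w g := by
  obtain ⟨u, ⟨w, hw, hlim, hcau⟩, hgu⟩ := hg
  refine ⟨fun n => axisymmetricProj (w n), fun n => (hw n).axisymmetricProj, ?_, ?_⟩
  · refine tendsto_of_tendsto_of_tendsto_of_le_of_le tendsto_const_nhds hlim (fun _ => zero_le)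
      fun n => ?_
    have hd : MemLp (fun x => w n x - u x) 2 (layMeasure θ) := (hw n).memLp.sub (Lp.memLp u)
    refine le_trans (eLpNorm_congr_ae ?_).le (eLpNorm_axisymmetricProj_le hd)
    filter_upwards [hgu, axisymmetricProj_sub_ae (hw n).memLp (Lp.memLp u)] with p h1 h2
    rw [h1, h2]
  · refine tendsto_of_tendsto_of_tendsto_of_le_of_le tendsto_const_nhds hcau
      (fun _ => guiForm₀_nonneg _ _ _) fun m => ?_
    have hd := (hw m.1).sub (hw m.2)
    refine le_trans (le_of_eq ?_) (guiForm₀_axisymmetricProj_le hd ω)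
    congr 1
    ext p
    have hi : ∀ n, IntegrableOn (fun φ => w n (p, φ)) (Set.Ioc 0 (2 * Real.pi)) := fun n =>
      (((hw n).1.continuous.comp (Continuous.prodMk_right p)).continuousOn.integrableOn_compact
        isCompact_Icc).mono_set Set.Ioc_subset_Icc_self
    simp only [axisymmetricProj_eq]
    rw [integral_sub (hi _) (hi _), sub_mul]

/-- The extension of a function on the meridian domain to an axisymmetric function on the layer,
normalized so that it is a right inverse of `axisymmetricProj`. -/
def axisymmetricExt (w : ℝ × ℝ → ℂ) (x : (ℝ × ℝ) × ℝ) : ℂ :=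
  ((1 / Real.sqrt (2 * Real.pi) : ℝ) : ℂ) * w x.1

theorem norm_inv_sqrt_two_pi_sq :
    ‖((1 / Real.sqrt (2 * Real.pi) : ℝ) : ℂ)‖ ^ 2 = (2 * Real.pi)⁻¹ := by
  rw [Complex.norm_real, Real.norm_eq_abs, sq_abs, div_pow, Real.sq_sqrt (by positivity), one_pow,
    one_div]

theorem axisymmetricProj_axisymmetricExt (w : ℝ × ℝ → ℂ) :
    axisymmetricProj (axisymmetricExt w) = w := by
  ext p
  have h : ((1 / Real.sqrt (2 * Real.pi) : ℝ) : ℂ) * ((1 / Real.sqrt (2 * Real.pi) : ℝ) : ℂ) =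
      ((2 * Real.pi)⁻¹ : ℝ) := by
    rw [← Complex.ofReal_mul, ← sq, div_pow, Real.sq_sqrt (by positivity), one_pow, one_div]
  have hpi : ((2 * Real.pi : ℝ) : ℂ) ≠ 0 := by
    exact_mod_cast (by positivity : 2 * Real.pi ≠ 0)
  rw [axisymmetricProj_eq]
  simp only [axisymmetricExt, setIntegral_const, measureReal_def, Real.volume_Ioc, sub_zero,
    ENNReal.toReal_ofReal (by positivity : 0 ≤ 2 * Real.pi), Complex.real_smul]
  calc _ = ((2 * Real.pi : ℝ) : ℂ) * (((1 / Real.sqrt (2 * Real.pi) : ℝ) : ℂ) *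
        ((1 / Real.sqrt (2 * Real.pi) : ℝ) : ℂ)) * w p := by ring
    _ = w p := by rw [h, Complex.ofReal_inv, mul_inv_cancel₀ hpi, one_mul]

theorem IsGuiTestFunction.axisymmetricExt {θ : ℝ} {w : ℝ × ℝ → ℂ} (hw : IsGuiTestFunction θ w) :
    IsLayTestFunction θ (axisymmetricExt w) := by
  obtain ⟨h, K, hK, hKG, h0⟩ := hw
  exact ⟨contDiff_const.mul (h.comp contDiff_fst), fun _ _ => rfl, K, hK, hKG, fun p hp φ => by
    simp [ConicalLayer.axisymmetricExt, h0 p hp]⟩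

theorem layComponent_axisymmetricExt {w : ℝ × ℝ → ℂ} (hw : Differentiable ℝ w) (ω : ℝ) (i : Fin 3) :
    layComponent ω (axisymmetricExt w) i = axisymmetricExt (guiComponent ω w i) := by
  have hd : ∀ x v, fderiv ℝ (axisymmetricExt w) x v =
      ((1 / Real.sqrt (2 * Real.pi) : ℝ) : ℂ) * fderiv ℝ w x.1 v.1 := fun x v => by
    have h := ((hw x.1).hasFDerivAt.comp x (hasFDerivAt_fst)).const_mul
      ((1 / Real.sqrt (2 * Real.pi) : ℝ) : ℂ)
    have h' : HasFDerivAt (axisymmetricExt w) _ x := h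
    rw [h'.fderiv]
    simp
  ext x
  fin_cases i
  · simp [layComponent, guiComponent, hd, axisymmetricExt]
  · simp [layComponent, guiComponent, hd, axisymmetricExt]
  · simp only [layComponent, guiComponent, hd, axisymmetricExt, Fin.reduceFinMk, Matrix.cons_val]
    have h0 : fderiv ℝ w x.1 (0, 0) = 0 := map_zero _
    rw [h0]
    push_cast
    ring

theorem layForm₀_axisymmetricExt {w : ℝ × ℝ → ℂ} {θ : ℝ} (hw : IsGuiTestFunction θ w) (ω : ℝ) :
    layForm₀ ω θ (axisymmetricExt w) = guiForm₀ ω θ w := by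
  have hI : Integrable (fun x => ∑ i, ‖layComponent ω (axisymmetricExt w) i x‖ ^ 2)
      (layMeasure θ) :=
    integrable_finsetSum _ fun i _ => hw.axisymmetricExt.integrable_norm_sq ω i
  rw [layForm₀_eq, guiForm₀, layMeasure, integral_prod _ hI]
  refine integral_congr_ae (Eventually.of_forall fun p => ?_)
  simp only [layComponent_axisymmetricExt hw.differentiable, axisymmetricExt, norm_mul, mul_pow,
    norm_inv_sqrt_two_pi_sq]
  rw [setIntegral_const, measureReal_def, Real.volume_Ioc, sub_zero,
    ENNReal.toReal_ofReal (by positivity : 0 ≤ 2 * Real.pi), ← Finset.mul_sum, smul_eq_mul,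
    ← mul_assoc, mul_inv_cancel₀ (by positivity), one_mul]

theorem eLpNorm_axisymmetricExt {θ : ℝ} {f : ℝ × ℝ → ℂ}
    (hf : AEStronglyMeasurable f (guiMeasure θ)) :
    eLpNorm (axisymmetricExt f) 2 (layMeasure θ) = eLpNorm f 2 (guiMeasure θ) := by
  have hm : AEStronglyMeasurable (axisymmetricExt f)
      ((guiMeasure θ).prod (volume.restrict (Set.Ioc 0 (2 * Real.pi)))) :=
    hf.comp_fst.const_mul _
  have hpi : 0 < 2 * Real.pi := by positivity
  have h2 : ‖((1 / Real.sqrt (2 * Real.pi) : ℝ) : ℂ)‖ₑ ^ 2 = (ENNReal.ofReal (2 * Real.pi))⁻¹ := by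
    rw [← ofReal_norm, ← ENNReal.ofReal_pow (norm_nonneg _), norm_inv_sqrt_two_pi_sq,
      ENNReal.ofReal_inv_of_pos hpi]
  rw [← (ENNReal.pow_right_strictMono two_ne_zero).injective.eq_iff]
  simp only [eLpNorm_two_sq]
  rw [layMeasure, lintegral_prod _ (by fun_prop)]
  refine lintegral_congr fun p => ?_
  simp only [axisymmetricExt, enorm_mul, mul_pow, h2]
  rw [setLIntegral_const, Real.volume_Ioc, sub_zero, mul_right_comm,
    ENNReal.inv_mul_cancel (by simpa using hpi) ENNReal.ofReal_ne_top, one_mul]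

theorem mem_fiberDomain_of_isFormApprox {ω θ : ℝ} {g : L2Gui θ} {w : ℕ → ℝ × ℝ → ℂ}
    (h : IsFormApprox ω θ w g) : g ∈ fiberDomain ω θ := by
  have hg : AEStronglyMeasurable g (guiMeasure θ) := (Lp.memLp g).1
  have hgm : MemLp (axisymmetricExt g) 2 (layMeasure θ) := by
    refine ⟨hg.comp_fst.const_mul _, ?_⟩
    rw [eLpNorm_axisymmetricExt hg]
    exact (Lp.memLp g).2
  have hsub : ∀ f f' : ℝ × ℝ → ℂ, (fun x => axisymmetricExt f x - axisymmetricExt f' x) =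
      axisymmetricExt fun p => f p - f' p := fun f f' => by
    ext x; simp [axisymmetricExt, mul_sub]
  refine ⟨hgm.toLp _, ⟨fun n => axisymmetricExt (w n), fun n => (h.test n).axisymmetricExt, ?_, ?_⟩,
    ?_⟩
  · refine h.tendsto.congr fun n => ?_
    have hm : AEStronglyMeasurable (fun p => w n p - g p) (guiMeasure θ) :=
      (h.test n).memLp.1.sub hg
    rw [← eLpNorm_axisymmetricExt hm, ← hsub]
    refine eLpNorm_congr_ae ?_
    filter_upwards [hgm.coeFn_toLp] with x hx
    rw [hx]
  · refine h.cauchy.congr fun m => ?_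
    rw [hsub, layForm₀_axisymmetricExt ((h.test _).sub (h.test _))]
  · have h1 : ∀ᵐ x ∂(guiMeasure θ).prod (volume.restrict (Set.Ioc 0 (2 * Real.pi))),
        hgm.toLp _ x = axisymmetricExt g x := hgm.coeFn_toLp
    filter_upwards [Measure.ae_ae_of_ae_prod h1] with p hp
    conv_lhs => rw [← axisymmetricProj_axisymmetricExt g]
    rw [axisymmetricProj_eq, axisymmetricProj_eq, integral_congr_ae hp]

/-- This eliminates the layer: approximants are averaged in one direction and extended
axisymmetrically, with equal form and norm, in the other. -/
theorem mem_fiberDomain_iff {ω θ : ℝ} {g : L2Gui θ} :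
    g ∈ fiberDomain ω θ ↔ ∃ w, IsFormApprox ω θ w g :=
  ⟨exists_isFormApprox_of_mem, fun ⟨_, h⟩ => mem_fiberDomain_of_isFormApprox h⟩

/-! ### Weak derivatives and the closed form -/

theorem memLp_div_radius {θ : ℝ} {ψ : ℝ × ℝ → ℝ} {K : Set (ℝ × ℝ)} (hK : IsCompact K)
    (hKG : K ⊆ Gui θ) (hψ : ContinuousOn ψ K) (h0 : ∀ p, p ∉ K → ψ p = 0) :
    MemLp (fun p => ((ψ p / p.1 : ℝ) : ℂ)) 2 (guiMeasure θ) := by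
  refine memLp_guiMeasure_of_continuousOn hK ?_ fun p hp => by simp [h0 p hp]
  exact Complex.continuous_ofReal.comp_continuousOn
    (hψ.div continuousOn_fst fun p hp => (hKG hp).1.ne')

/-- On a compact subset 1 / r is bounded, so Hölder with 1 / r removes the weight. -/
theorem locallyIntegrableOn_Gui {θ : ℝ} {f : ℝ × ℝ → ℂ} (hf : MemLp f 2 (guiMeasure θ)) :
    LocallyIntegrableOn f (Gui θ) := by
  refine (locallyIntegrableOn_iff (isOpen_Gui θ).isLocallyClosed).2 fun K hKG hK => ?_
  have h1 := memLp_div_radius (ψ := K.indicator 1) hK hKG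
    (continuousOn_const.congr fun p hp => Set.indicator_of_mem hp _)
    fun p hp => Set.indicator_of_notMem hp _
  have h2 : Integrable (fun p => ((K.indicator 1 p / p.1 : ℝ) : ℂ) * f p) (guiMeasure θ) :=
    h1.integrable_mul hf
  rw [guiMeasure, integrable_withDensity_iff_integrable_smul' (by fun_prop) (by simp)] at h2
  have h3 : IntegrableOn (fun p => (ENNReal.ofReal p.1).toReal •
      (((K.indicator 1 p / p.1 : ℝ) : ℂ) * f p)) K := IntegrableOn.mono_set h2 hKG
  refine h3.congr_fun (fun p hp => ?_) hK.measurableSet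
  have hr := (hKG hp).1
  have hr' : (p.1 : ℂ) ≠ 0 := by exact_mod_cast hr.ne'
  simp only [Set.indicator_of_mem hp, Pi.one_apply, ENNReal.toReal_ofReal hr.le, Complex.real_smul]
  push_cast
  field_simp

/-- The unweighted pairing with ψ is the weighted inner product with ψ / r, hence continuous on the
Hilbert space. -/
theorem tendsto_setIntegral_smul {θ : ℝ} {ψ : ℝ × ℝ → ℝ} (hψ : Continuous ψ)
    (hc : HasCompactSupport ψ) (hs : tsupport ψ ⊆ Gui θ) {h : ℕ → L2Gui θ} {H : L2Gui θ}
    (hh : Tendsto h atTop (𝓝 H)) :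
    Tendsto (fun n => ∫ p in Gui θ, ψ p • h n p) atTop (𝓝 (∫ p in Gui θ, ψ p • H p)) := by
  have hm := memLp_div_radius hc hs hψ.continuousOn fun p hp => image_eq_zero_of_notMem_tsupport hp
  have key : ∀ f : L2Gui θ, ∫ p in Gui θ, ψ p • f p = inner ℂ (hm.toLp _) f := fun f => by
    have h1 : inner ℂ (hm.toLp _) f = ∫ p, (ψ p / p.1) • f p ∂guiMeasure θ := by
      rw [L2.inner_def]
      refine integral_congr_ae ?_
      filter_upwards [hm.coeFn_toLp] with p hp
      rw [hp, RCLike.inner_apply, Complex.conj_ofReal, Complex.real_smul, mul_comm]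
    rw [h1, integral_guiMeasure]
    refine setIntegral_congr_fun (isOpen_Gui θ).measurableSet fun p hp => ?_
    simp only [smul_smul, mul_div_cancel₀ _ (hp.1.ne')]
  simp only [key]
  exact tendsto_const_nhds.inner hh

theorem IsGuiTestFunction.integral_fderiv_smul {θ : ℝ} {w : ℝ × ℝ → ℂ}
    (hw : IsGuiTestFunction θ w) (v : ℝ × ℝ) {η : ℝ × ℝ → ℝ}
    (hη : ContDiff ℝ ((⊤ : ℕ∞) : WithTop ℕ∞) η) :
    ∫ p in Gui θ, fderiv ℝ η p v • w p = -∫ p in Gui θ, η p • fderiv ℝ w p v := by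
  obtain ⟨K, hK, hKG, h0⟩ := hw.2
  have hd : ∀ p, p ∉ K → fderiv ℝ w p v = 0 := fun p hp => by
    simp [fderiv_eq_zero_of_compl hK.isClosed h0 hp]
  have hint : ∀ f : ℝ × ℝ → ℂ, Continuous f → (∀ p, p ∉ K → f p = 0) → Integrable f :=
    fun f hf hf0 => (hf.continuousOn.integrableOn_compact hK).integrable_of_forall_notMem_eq_zero hf0
  have hηc := hη.continuous
  have hwc := hw.1.continuous
  have hηd : Continuous fun p => fderiv ℝ η p v :=
    (hη.continuous_fderiv (by simp)).clm_apply continuous_const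
  have hwd := hw.continuous_fderiv v
  rw [setIntegral_eq_integral_of_forall_compl_eq_zero fun p hp => by
      simp [h0 p fun h => hp (hKG h)],
    setIntegral_eq_integral_of_forall_compl_eq_zero fun p hp => by
      simp [hd p fun h => hp (hKG h)],
    integral_smul_fderiv_eq_neg_fderiv_smul_of_integrable
      (hint _ (by fun_prop) fun p hp => by simp [h0 p hp])
      (hint _ (by fun_prop) fun p hp => by simp [hd p hp])
      (hint _ (by fun_prop) fun p hp => by simp [h0 p hp])
      (fun p _ => hη.differentiable (by simp) p) (fun p _ => hw.differentiable p), neg_neg]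

/-- Weak differentiation is closed: integration by parts holds for each approximant, and both sides
pass to the limit. -/
theorem isWeakDeriv_of_tendsto {θ : ℝ} {w : ℕ → ℝ × ℝ → ℂ} (hw : ∀ n, IsGuiTestFunction θ (w n))
    {v : ℝ × ℝ} {W D : ℕ → L2Gui θ} (hW : ∀ n, W n =ᵐ[guiMeasure θ] w n)
    (hD : ∀ n, D n =ᵐ[guiMeasure θ] fun p => fderiv ℝ (w n) p v) {g G : L2Gui θ}
    (hWg : Tendsto W atTop (𝓝 g)) (hDG : Tendsto D atTop (𝓝 G)) :
    IsWeakDeriv (Gui θ) g G v := by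
  refine ⟨locallyIntegrableOn_Gui (Lp.memLp g), locallyIntegrableOn_Gui (Lp.memLp G),
    fun η hη hc hs => ?_⟩
  have hηd : Continuous fun p => fderiv ℝ η p v :=
    (hη.continuous_fderiv (by simp)).clm_apply continuous_const
  have h1 := tendsto_setIntegral_smul hηd (hc.fderiv_apply ℝ v)
    ((tsupport_fderiv_apply_subset ℝ v).trans hs) hWg
  have h2 := (tendsto_setIntegral_smul hη.continuous hc hs hDG).neg
  refine tendsto_nhds_unique h1 (h2.congr fun n => ?_)
  have hW' := (restrict_Gui_absolutelyContinuous θ).ae_eq (hW n)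
  have hD' := (restrict_Gui_absolutelyContinuous θ).ae_eq (hD n)
  have e1 : ∫ p in Gui θ, fderiv ℝ η p v • W n p = ∫ p in Gui θ, fderiv ℝ η p v • w n p :=
    integral_congr_ae (by filter_upwards [hW'] with p hp; rw [hp])
  have e2 : ∫ p in Gui θ, η p • D n p = ∫ p in Gui θ, η p • fderiv ℝ (w n) p v :=
    integral_congr_ae (by filter_upwards [hD'] with p hp; rw [hp])
  rw [e1, e2, (hw n).integral_fderiv_smul v hη]

theorem IsWeakDeriv.ae_eq {U : Set (ℝ × ℝ)} (hU : IsOpen U) {u g g' : ℝ × ℝ → ℂ} {v : ℝ × ℝ}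
    (h : IsWeakDeriv U u g v) (h' : IsWeakDeriv U u g' v) : g =ᵐ[volume.restrict U] g' := by
  have hint : ∀ (η : ℝ × ℝ → ℝ) (f : ℝ × ℝ → ℂ), Continuous η → HasCompactSupport η →
      tsupport η ⊆ U → LocallyIntegrableOn f U → Integrable fun p => η p • f p := by
    intro η f hη hc hs hf
    have h1 : IntegrableOn f (tsupport η) := hf.integrableOn_compact_subset hs hc
    exact (h1.continuousOn_smul hη.continuousOn hc).integrable_of_forall_notMem_eq_zero
      fun p hp => by simp [image_eq_zero_of_notMem_tsupport hp]
  have h0 : ∀ᵐ p : ℝ × ℝ, p ∈ U → (fun p => g p - g' p) p = 0 := by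
    refine hU.ae_eq_zero_of_integral_contDiff_smul_eq_zero (h.2.1.sub h'.2.1) fun η hη hc hs => ?_
    have e1 := h.2.2 η hη hc hs
    have e2 := h'.2.2 η hη hc hs
    have hz : ∀ f : ℝ × ℝ → ℂ, ∫ p in U, η p • f p = ∫ p, η p • f p := fun f =>
      setIntegral_eq_integral_of_forall_compl_eq_zero fun p hp => by
        simp [image_eq_zero_of_notMem_tsupport fun h => hp (hs h)]
    rw [e1, neg_inj, hz, hz] at e2
    simp only [smul_sub]
    rw [integral_sub (hint η g hη.continuous hc hs h.2.1) (hint η g' hη.continuous hc hs h'.2.1),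
      e2, sub_self]
  filter_upwards [ae_restrict_of_ae h0, ae_restrict_mem hU.measurableSet] with p hp hpU
  exact sub_eq_zero.1 (hp hpU)

/-- Uniqueness makes the choice inside `weakDeriv` harmless. -/
theorem IsWeakDeriv.weakDeriv_ae_eq {U : Set (ℝ × ℝ)} (hU : IsOpen U) {u g : ℝ × ℝ → ℂ}
    {v : ℝ × ℝ} (h : IsWeakDeriv U u g v) : weakDeriv U u v =ᵐ[volume.restrict U] g := by
  have hex : ∃ g, IsWeakDeriv U u g v := ⟨g, h⟩
  rw [weakDeriv, dif_pos hex]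
  exact hex.choose_spec.ae_eq hU h

theorem integral_norm_sq_eq {α : Type*} {m : MeasurableSpace α} {μ : Measure α} {f : α → ℂ}
    {F : Lp ℂ 2 μ} (hf : F =ᵐ[μ] f) : ∫ x, ‖f x‖ ^ 2 ∂μ = ‖F‖ ^ 2 := by
  have h : ∫ x, inner ℂ (F x) (F x) ∂μ = ∫ x, ((‖f x‖ ^ 2 : ℝ) : ℂ) ∂μ := by
    refine integral_congr_ae ?_
    filter_upwards [hf] with x hx
    rw [hx, inner_self_eq_norm_sq_to_K]
    norm_cast
  rw [← inner_self_eq_norm_sq (𝕜 := ℂ), L2.inner_def, h, integral_complex_ofReal]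
  rfl

theorem guiForm₀_eq_sum {ω θ : ℝ} {w : ℝ × ℝ → ℂ} (hw : IsGuiTestFunction θ w) :
    guiForm₀ ω θ w = ∑ i, ‖(hw.memLp_guiComponent ω i).toLp‖ ^ 2 := by
  rw [guiForm₀, integral_finsetSum _ fun i _ =>
    (hw.memLp_guiComponent ω i).integrable_norm_pow two_ne_zero]
  exact Finset.sum_congr rfl fun i _ => integral_norm_sq_eq (MemLp.coeFn_toLp _)

theorem IsFormApprox.cauchySeq {ω θ : ℝ} {w : ℕ → ℝ × ℝ → ℂ} {g : ℝ × ℝ → ℂ}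
    (h : IsFormApprox ω θ w g) (i : Fin 3) :
    CauchySeq fun n => ((h.test n).memLp_guiComponent ω i).toLp := by
  rw [cauchySeq_iff_tendsto_dist_atTop_0]
  have hs := (h.cauchy.sqrt)
  rw [Real.sqrt_zero] at hs
  refine squeeze_zero (fun _ => dist_nonneg) (fun m => ?_) hs
  refine Real.le_sqrt_of_sq_le ?_
  rw [guiForm₀_eq_sum ((h.test m.1).sub (h.test m.2)), dist_eq_norm, ← MemLp.toLp_sub]
  refine le_trans (le_of_eq ?_) (Finset.single_le_sum (f := fun i =>
    ‖(((h.test m.1).sub (h.test m.2)).memLp_guiComponent ω i).toLp‖ ^ 2)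
    (fun _ _ => by positivity) (Finset.mem_univ i))
  simp only [Lp.norm_toLp, guiComponent_sub (h.test m.1).differentiable
    (h.test m.2).differentiable]
  rfl

theorem IsFormApprox.tendsto_toLp {ω θ : ℝ} {w : ℕ → ℝ × ℝ → ℂ} {g : L2Gui θ}
    (h : IsFormApprox ω θ w g) : Tendsto (fun n => (h.test n).memLp.toLp) atTop (𝓝 g) := by
  have := (Lp.tendsto_Lp_iff_tendsto_eLpNorm'' w (fun n => (h.test n).memLp) g (Lp.memLp g)).2
    h.tendsto
  rwa [Lp.toLp_coeFn] at this

/-- The form of the axisymmetric fiber, written with weak derivatives, is the closure of the form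
on `C_0^∞(Gui(θ))`. -/
theorem IsFormApprox.tendsto_guiForm₀ {ω θ : ℝ} {w : ℕ → ℝ × ℝ → ℂ} {g : L2Gui θ}
    (h : IsFormApprox ω θ w g) :
    Tendsto (fun n => guiForm₀ ω θ (w n)) atTop (𝓝 (fiberForm ω θ g)) := by
  choose G hG using fun i => cauchySeq_tendsto_of_complete (h.cauchySeq i)
  have hac := guiMeasure_absolutelyContinuous θ
  have hd : ∀ i v, (∀ n, guiComponent ω (w n) i = fun p => fderiv ℝ (w n) p v) →
      weakDeriv (Gui θ) g v =ᵐ[guiMeasure θ] G i := fun i v hv =>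
    hac.ae_eq (IsWeakDeriv.weakDeriv_ae_eq (isOpen_Gui θ) (isWeakDeriv_of_tendsto h.test
      (fun n => (h.test n).memLp.coeFn_toLp) (fun n => by
        rw [← hv n]; exact ((h.test n).memLp_guiComponent ω i).coeFn_toLp) h.tendsto_toLp (hG i)))
  have h0 := hd 0 (1, 0) fun n => rfl
  have h1 := hd 1 (0, 1) fun n => rfl
  -- Multiplication by ω / r need not be bounded on L², so the limit is identified pointwise along a
  -- subsequence on which both sequences converge almost everywhere.
  have h2 : (fun p => ((ω / p.1 : ℝ) : ℂ) * g p) =ᵐ[guiMeasure θ] G 2 := by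
    obtain ⟨ns, hns, hae⟩ := (tendstoInMeasure_of_tendsto_Lp h.tendsto_toLp).exists_seq_tendsto_ae
    obtain ⟨ms, hms, hae'⟩ := (tendstoInMeasure_of_tendsto_Lp
      ((hG 2).comp hns.tendsto_atTop)).exists_seq_tendsto_ae
    have e1 := ae_all_iff.2 fun n => (h.test n).memLp.coeFn_toLp
    have e2 := ae_all_iff.2 fun n => ((h.test n).memLp_guiComponent ω 2).coeFn_toLp
    filter_upwards [hae, hae', e1, e2] with p hp hp' q1 q2
    have l1 := (hp.comp hms.tendsto_atTop).const_mul ((ω / p.1 : ℝ) : ℂ)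
    refine tendsto_nhds_unique l1 (hp'.congr fun n => ?_)
    simp only [Function.comp_apply, q1, q2]
    rfl
  have hlim : Tendsto (fun n => guiForm₀ ω θ (w n)) atTop (𝓝 (∑ i, ‖G i‖ ^ 2)) := by
    simp only [fun n => guiForm₀_eq_sum (ω := ω) (h.test n)]
    exact tendsto_finsetSum _ fun i _ => (hG i).norm.pow 2
  have heq : fiberForm ω θ g = ∑ i, ‖G i‖ ^ 2 := by
    have hsum : ∑ i, ‖G i‖ ^ 2 = ∫ p, ∑ i, ‖G i p‖ ^ 2 ∂guiMeasure θ := by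
      rw [integral_finsetSum _ fun i _ => (Lp.memLp (G i)).integrable_norm_pow two_ne_zero]
      exact Finset.sum_congr rfl fun i _ => (integral_norm_sq_eq (ae_eq_refl _)).symm
    rw [hsum, fiberForm]
    refine integral_congr_ae ?_
    filter_upwards [h0, h1, h2] with p q0 q1 q2
    rw [Fin.sum_univ_three, q0, q1, ← q2, norm_mul, mul_pow, Complex.norm_real, Real.norm_eq_abs,
      sq_abs, div_pow]
  rwa [heq]

theorem IsFormApprox.congr {ω θ : ℝ} {w : ℕ → ℝ × ℝ → ℂ} {g g' : ℝ × ℝ → ℂ}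
    (h : IsFormApprox ω θ w g) (hg : g =ᵐ[guiMeasure θ] g') : IsFormApprox ω θ w g' :=
  ⟨h.test, h.tendsto.congr fun n => eLpNorm_congr_ae (by filter_upwards [hg] with p hp; rw [hp]),
    h.cauchy⟩

/-! ### The linear change of variables between two meridian domains -/

/-- The linear map `(r, z) ↦ (c r, a r + b z)` that sends `Gui(θ)` onto `Gui(θ')`: it preserves the
distance `r cos θ - z sin θ` to the lower side and scales the radius by `cos θ' / cos θ`. -/
def shear (θ θ' : ℝ) : ℝ × ℝ →L[ℝ] ℝ × ℝ :=
  ((Real.cos θ' / Real.cos θ) • ContinuousLinearMap.fst ℝ ℝ ℝ).prod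
    (((Real.cos θ' / Real.cos θ * Real.cos θ' - Real.cos θ) / Real.sin θ') •
        ContinuousLinearMap.fst ℝ ℝ ℝ +
      (Real.sin θ / Real.sin θ') • ContinuousLinearMap.snd ℝ ℝ ℝ)

theorem shear_apply (θ θ' : ℝ) (p : ℝ × ℝ) :
    shear θ θ' p = (Real.cos θ' / Real.cos θ * p.1,
      (Real.cos θ' / Real.cos θ * Real.cos θ' - Real.cos θ) / Real.sin θ' * p.1 +
        Real.sin θ / Real.sin θ' * p.2) := by
  simp [shear]

theorem cos_pos_of_mem {θ : ℝ} (hθ : θ ∈ Set.Ioo 0 (Real.pi / 2)) : 0 < Real.cos θ :=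
  Real.cos_pos_of_mem_Ioo ⟨by linarith [hθ.1, Real.pi_pos], hθ.2⟩

theorem sin_pos_of_mem {θ : ℝ} (hθ : θ ∈ Set.Ioo 0 (Real.pi / 2)) : 0 < Real.sin θ :=
  Real.sin_pos_of_pos_of_lt_pi hθ.1 (by linarith [hθ.2, Real.pi_pos])

/-- Multiplying by cos θ > 0 turns the oblique constraints into bounds on the distance to the side.
The lower bound on z is redundant, as r > 0 and that distance is below π. -/
theorem mem_Gui_iff {θ : ℝ} (hθ : θ ∈ Set.Ioo 0 (Real.pi / 2)) (p : ℝ × ℝ) : p ∈ Gui θ ↔ 0 < p.1 ∧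
    0 < p.1 * Real.cos θ - p.2 * Real.sin θ ∧ p.1 * Real.cos θ - p.2 * Real.sin θ < Real.pi := by
  have hc := cos_pos_of_mem hθ
  have hs := sin_pos_of_mem hθ
  have h1 : p.2 * Real.tan θ < p.1 ↔ 0 < p.1 * Real.cos θ - p.2 * Real.sin θ := by
    rw [Real.tan_eq_sin_div_cos, ← mul_div_assoc, div_lt_iff₀ hc, sub_pos]
  have h2 : p.1 < p.2 * Real.tan θ + Real.pi / Real.cos θ ↔
      p.1 * Real.cos θ - p.2 * Real.sin θ < Real.pi := by
    rw [Real.tan_eq_sin_div_cos, ← mul_div_assoc, ← add_div, lt_div_iff₀ hc, sub_lt_iff_lt_add']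
  rw [Gui, Set.mem_ofPred_eq, max_lt_iff, h1, h2]
  refine ⟨fun h => ⟨h.1, h.2.2.1.2, h.2.2.2⟩, fun h => ⟨h.1, ?_, ⟨h.1, h.2.1⟩, h.2.2⟩⟩
  rw [neg_lt, ← sub_pos, ← mul_pos_iff_of_pos_right hs, sub_mul, div_mul_cancel₀ _ hs.ne']
  nlinarith [mul_pos h.1 hc, h.2.2]

theorem shear_shear {θ θ' : ℝ} (hθ : θ ∈ Set.Ioo 0 (Real.pi / 2))
    (hθ' : θ' ∈ Set.Ioo 0 (Real.pi / 2)) (p : ℝ × ℝ) : shear θ' θ (shear θ θ' p) = p := by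
  have hc := (cos_pos_of_mem hθ).ne'
  have hs := (sin_pos_of_mem hθ).ne'
  have hc' := (cos_pos_of_mem hθ').ne'
  have hs' := (sin_pos_of_mem hθ').ne'
  simp only [shear_apply]
  ext
  · field_simp
  · field_simp
    ring

theorem shear_mem_Gui_iff {θ θ' : ℝ} (hθ : θ ∈ Set.Ioo 0 (Real.pi / 2))
    (hθ' : θ' ∈ Set.Ioo 0 (Real.pi / 2)) (p : ℝ × ℝ) : shear θ θ' p ∈ Gui θ' ↔ p ∈ Gui θ := by
  have hc := cos_pos_of_mem hθ
  have hc' := cos_pos_of_mem hθ'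
  have hs' := (sin_pos_of_mem hθ').ne'
  have h : (shear θ θ' p).1 * Real.cos θ' - (shear θ θ' p).2 * Real.sin θ' =
      p.1 * Real.cos θ - p.2 * Real.sin θ := by
    simp only [shear_apply]
    field_simp
    ring
  rw [mem_Gui_iff hθ', mem_Gui_iff hθ, h]
  simp only [shear_apply, mul_pos_iff_of_pos_left (div_pos hc' hc)]

theorem measurableEmbedding_shear {θ θ' : ℝ} (hθ : θ ∈ Set.Ioo 0 (Real.pi / 2))
    (hθ' : θ' ∈ Set.Ioo 0 (Real.pi / 2)) : MeasurableEmbedding (shear θ θ') :=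
  (ContinuousLinearEquiv.equivOfInverse (shear θ θ') (shear θ' θ) (shear_shear hθ hθ')
    (shear_shear hθ' hθ)).toHomeomorph.measurableEmbedding

/-- Lebesgue measure scales by the inverse absolute determinant, and the density r by cos θ / cos
θ'. -/
theorem exists_map_shear_guiMeasure {θ θ' : ℝ} (hθ : θ ∈ Set.Ioo 0 (Real.pi / 2))
    (hθ' : θ' ∈ Set.Ioo 0 (Real.pi / 2)) :
    ∃ κ : ℝ, 0 < κ ∧ (guiMeasure θ).map (shear θ θ') = ENNReal.ofReal κ • guiMeasure θ' := by
  have hme := measurableEmbedding_shear hθ hθ'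
  have hdet : LinearMap.det (shear θ θ' : ℝ × ℝ →ₗ[ℝ] ℝ × ℝ) ≠ 0 := by
    have h : (shear θ' θ : ℝ × ℝ →ₗ[ℝ] ℝ × ℝ) ∘ₗ (shear θ θ' : ℝ × ℝ →ₗ[ℝ] ℝ × ℝ) = LinearMap.id :=
      LinearMap.ext (shear_shear hθ hθ')
    intro h0
    have := congrArg LinearMap.det h
    rw [LinearMap.det_comp, h0, mul_zero, LinearMap.det_id] at this
    exact zero_ne_one this
  have hmap := Measure.map_linearMap_addHaar_eq_smul_addHaar volume hdet
  set δ : ℝ := |(LinearMap.det (shear θ θ' : ℝ × ℝ →ₗ[ℝ] ℝ × ℝ))⁻¹| with hδ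
  have hδ0 : 0 < δ := abs_pos.2 (inv_ne_zero hdet)
  have hc := cos_pos_of_mem hθ
  have hc' := cos_pos_of_mem hθ'
  have hr : 0 < Real.cos θ / Real.cos θ' := div_pos hc hc'
  refine ⟨Real.cos θ / Real.cos θ' * δ, mul_pos hr hδ0, Measure.ext fun S hS => ?_⟩
  have hpre : shear θ θ' ⁻¹' (S ∩ Gui θ') = shear θ θ' ⁻¹' S ∩ Gui θ := by
    ext p
    simp [shear_mem_Gui_iff hθ hθ']
  have hSm := (shear θ θ').continuous.measurable hS
  have hfun : ∀ p : ℝ × ℝ, ENNReal.ofReal p.1 =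
      ENNReal.ofReal (Real.cos θ / Real.cos θ') * ENNReal.ofReal (shear θ θ' p).1 := fun p => by
    simp only [shear_apply]
    rw [← ENNReal.ofReal_mul hr.le]
    congr 1
    field_simp
  rw [hme.map_apply, guiMeasure, withDensity_apply _ hSm, Measure.restrict_restrict hSm, ← hpre,
    lintegral_congr hfun, 
    ← hme.lintegral_map (fun q => ENNReal.ofReal (Real.cos θ / Real.cos θ') * ENNReal.ofReal q.1), ← hme.restrict_map]
  have hmap' : volume.map (shear θ θ') = ENNReal.ofReal δ • (volume : Measure (ℝ × ℝ)) := hmap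
  rw [hmap', Measure.restrict_smul, lintegral_smul_measure, lintegral_const_mul _ (by fun_prop),
    Measure.smul_apply, guiMeasure, withDensity_apply _ hS, Measure.restrict_restrict hS,
    ENNReal.ofReal_mul hr.le, smul_eq_mul, smul_eq_mul]
  ring

theorem IsGuiTestFunction.comp_shear {θ θ' : ℝ} (hθ : θ ∈ Set.Ioo 0 (Real.pi / 2))
    (hθ' : θ' ∈ Set.Ioo 0 (Real.pi / 2)) {w : ℝ × ℝ → ℂ} (hw : IsGuiTestFunction θ' w) :
    IsGuiTestFunction θ fun p => w (shear θ θ' p) := by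
  obtain ⟨h, K, hK, hKG, h0⟩ := hw
  refine ⟨h.comp (shear θ θ').contDiff, shear θ' θ '' K, hK.image (shear θ' θ).continuous, ?_,
    fun p hp => h0 _ fun hpK => hp ⟨_, hpK, shear_shear hθ hθ' p⟩⟩
  rintro _ ⟨q, hq, rfl⟩
  exact (shear_mem_Gui_iff hθ' hθ q).2 (hKG hq)

/-- In the frames along and across the sides at the two angles the transposed map is diagonal, with
entries tan θ / tan θ' and 1; `hA` and `hB` are these two rows. -/
theorem shear_quadratic_le {θ θ' : ℝ} (hθ : θ ∈ Set.Ioo 0 (Real.pi / 2))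
    (hθ' : θ' ∈ Set.Ioo 0 (Real.pi / 2)) {C : ℝ} (h1 : 1 ≤ C)
    (hC : (Real.sin θ * Real.cos θ' / (Real.cos θ * Real.sin θ')) ^ 2 ≤ C) (x y : ℝ) :
    (Real.cos θ' / Real.cos θ * x +
        (Real.cos θ' / Real.cos θ * Real.cos θ' - Real.cos θ) / Real.sin θ' * y) ^ 2 +
      (Real.sin θ / Real.sin θ' * y) ^ 2 ≤ C * (x ^ 2 + y ^ 2) := by
  have hc := (cos_pos_of_mem hθ).ne'
  have hs' := (sin_pos_of_mem hθ').ne'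
  have e := Real.sin_sq_add_cos_sq θ
  have e' := Real.sin_sq_add_cos_sq θ'
  set c := Real.cos θ
  set s := Real.sin θ
  set c' := Real.cos θ'
  set s' := Real.sin θ'
  set X := c' / c * x + (c' / c * c' - c) / s' * y with hX
  set Y := s / s' * y with hY
  have hR : X ^ 2 + Y ^ 2 = (s * X + c * Y) ^ 2 + (c * X - s * Y) ^ 2 := by
    linear_combination (-(X ^ 2 + Y ^ 2)) * e
  have hA : s * X + c * Y = s * c' / (c * s') * (s' * x + c' * y) := by
    rw [hX, hY]
    field_simp
    ring
  have hB : c * X - s * Y = c' * x - s' * y := by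
    rw [hX, hY]
    field_simp
    linear_combination (-y) * e + y * e'
  have hR' : x ^ 2 + y ^ 2 = (s' * x + c' * y) ^ 2 + (c' * x - s' * y) ^ 2 := by
    linear_combination (-(x ^ 2 + y ^ 2)) * e'
  rw [hR, hA, hB, hR', mul_pow, mul_add]
  gcongr
  nlinarith [sq_nonneg (c' * x - s' * y)]

theorem sum_guiComponent_comp_shear_le {θ θ' : ℝ} (hθ : θ ∈ Set.Ioo 0 (Real.pi / 2))
    (hθ' : θ' ∈ Set.Ioo 0 (Real.pi / 2)) {C ω ω' : ℝ} (h1 : 1 ≤ C)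
    (hC : (Real.sin θ * Real.cos θ' / (Real.cos θ * Real.sin θ')) ^ 2 ≤ C)
    (hω : (Real.cos θ' / Real.cos θ * ω) ^ 2 ≤ C * ω' ^ 2)
    {w : ℝ × ℝ → ℂ} (hw : Differentiable ℝ w) (p : ℝ × ℝ) :
    ∑ i, ‖guiComponent ω (fun p => w (shear θ θ' p)) i p‖ ^ 2 ≤
      C * ∑ i, ‖guiComponent ω' w i (shear θ θ' p)‖ ^ 2 := by
  have hd : ∀ v, fderiv ℝ (fun p => w (shear θ θ' p)) p v =
      fderiv ℝ w (shear θ θ' p) (shear θ θ' v) := fun v => by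
    have h : HasFDerivAt (fun p => w (shear θ θ' p)) _ p :=
      (hw (shear θ θ' p)).hasFDerivAt.comp p (shear θ θ').hasFDerivAt
    rw [h.fderiv]
    rfl
  set q := shear θ θ' p with hq
  have hlin : ∀ a b : ℝ, fderiv ℝ w q (a, b) =
      a • fderiv ℝ w q (1, 0) + b • fderiv ℝ w q (0, 1) := fun a b => by
    rw [← map_smul, ← map_smul, ← map_add]
    simp
  have hquad := shear_quadratic_le hθ hθ' h1 hC
  have hc := cos_pos_of_mem hθ
  have hc' := cos_pos_of_mem hθ'
  have hq1 : q.1 = Real.cos θ' / Real.cos θ * p.1 := by rw [hq, shear_apply]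
  have h3 : (ω / p.1) ^ 2 ≤ C * (ω' / q.1) ^ 2 := by
    have : (ω / p.1) ^ 2 = (Real.cos θ' / Real.cos θ * ω) ^ 2 * (q.1⁻¹) ^ 2 := by
      rw [hq1]
      field_simp
    rw [this, div_eq_mul_inv ω', mul_pow ω', ← mul_assoc]
    gcongr
  simp only [Fin.sum_univ_three, guiComponent, Matrix.cons_val, hd, shear_apply θ θ' (1, 0),
    shear_apply θ θ' (0, 1), mul_one, mul_zero, add_zero, zero_add]
  rw [hlin (Real.cos θ' / Real.cos θ), hlin 0 (Real.sin θ / Real.sin θ'), zero_smul, zero_add, mul_add, norm_mul, norm_mul,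
    mul_pow, mul_pow, Complex.norm_real, Complex.norm_real, Real.norm_eq_abs, Real.norm_eq_abs,
    sq_abs, sq_abs, ← mul_assoc]
  refine add_le_add ?_ (by gcongr)
  -- The real quadratic inequality is applied to real and imaginary parts separately.
  simp only [← Complex.normSq_eq_norm_sq, Complex.normSq_apply, Complex.add_re, Complex.add_im,
    Complex.smul_re, Complex.smul_im, smul_eq_mul]
  set D := fderiv ℝ w q
  nlinarith [hquad (D (1, 0)).re (D (0, 1)).re, hquad (D (1, 0)).im (D (0, 1)).im]

theorem integral_comp_shear {θ θ' κ : ℝ} (hθ : θ ∈ Set.Ioo 0 (Real.pi / 2))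
    (hθ' : θ' ∈ Set.Ioo 0 (Real.pi / 2)) (hκ : 0 < κ)
    (hmap : (guiMeasure θ).map (shear θ θ') = ENNReal.ofReal κ • guiMeasure θ')
    {E : Type*} [NormedAddCommGroup E] [NormedSpace ℝ E]
    (f : ℝ × ℝ → E) :
    ∫ p, f (shear θ θ' p) ∂guiMeasure θ = κ • ∫ q, f q ∂guiMeasure θ' := by
  rw [← (measurableEmbedding_shear hθ hθ').integral_map, hmap, integral_smul_measure,
    ENNReal.toReal_ofReal hκ.le]

theorem memLp_comp_shear {θ θ' κ : ℝ} (hθ : θ ∈ Set.Ioo 0 (Real.pi / 2))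
    (hθ' : θ' ∈ Set.Ioo 0 (Real.pi / 2))
    (hmap : (guiMeasure θ).map (shear θ θ') = ENNReal.ofReal κ • guiMeasure θ')
    {f : ℝ × ℝ → ℂ} (hf : MemLp f 2 (guiMeasure θ')) :
    MemLp (fun p => f (shear θ θ' p)) 2 (guiMeasure θ) := by
  have h : MemLp f 2 ((guiMeasure θ).map (shear θ θ')) := by
    rw [hmap]
    exact hf.smul_measure ENNReal.ofReal_ne_top
  exact (measurableEmbedding_shear hθ hθ').memLp_map_measure_iff.1 h

theorem guiForm₀_comp_shear_le {θ θ' κ : ℝ} (hθ : θ ∈ Set.Ioo 0 (Real.pi / 2))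
    (hθ' : θ' ∈ Set.Ioo 0 (Real.pi / 2)) (hκ : 0 < κ)
    (hmap : (guiMeasure θ).map (shear θ θ') = ENNReal.ofReal κ • guiMeasure θ')
    {C ω ω' : ℝ} (h1 : 1 ≤ C)
    (hC : (Real.sin θ * Real.cos θ' / (Real.cos θ * Real.sin θ')) ^ 2 ≤ C)
    (hω : (Real.cos θ' / Real.cos θ * ω) ^ 2 ≤ C * ω' ^ 2)
    {w : ℝ × ℝ → ℂ} (hw : IsGuiTestFunction θ' w) :
    guiForm₀ ω θ (fun p => w (shear θ θ' p)) ≤ C * κ * guiForm₀ ω' θ' w := by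
  have hi : Integrable (fun p => ∑ i, ‖guiComponent ω' w i (shear θ θ' p)‖ ^ 2) (guiMeasure θ) :=
    integrable_finsetSum _ fun i _ => (memLp_comp_shear hθ hθ' hmap
      (hw.memLp_guiComponent ω' i)).integrable_norm_pow two_ne_zero
  refine (integral_mono ((hw.comp_shear hθ hθ').integrable_form ω) (hi.const_mul C) fun p =>
    sum_guiComponent_comp_shear_le hθ hθ' h1 hC hω hw.differentiable p).trans_eq ?_
  rw [integral_const_mul, integral_comp_shear hθ hθ' hκ hmap
    (fun q => ∑ i, ‖guiComponent ω' w i q‖ ^ 2), smul_eq_mul, guiForm₀, mul_assoc]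

/-- Membership in the form domain needs only some finite constant, so no order between the angles or
the fluxes is required; it thus serves the map and its inverse alike. -/
theorem IsFormApprox.comp_shear {θ θ' κ : ℝ} (hθ : θ ∈ Set.Ioo 0 (Real.pi / 2))
    (hθ' : θ' ∈ Set.Ioo 0 (Real.pi / 2)) (hκ : 0 < κ)
    (hmap : (guiMeasure θ).map (shear θ θ') = ENNReal.ofReal κ • guiMeasure θ')
    {ω ω' : ℝ} (hω' : ω' ≠ 0) {w : ℕ → ℝ × ℝ → ℂ} {g : ℝ × ℝ → ℂ}
    (h : IsFormApprox ω' θ' w g) :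
    IsFormApprox ω θ (fun n p => w n (shear θ θ' p)) (fun p => g (shear θ θ' p)) := by
  refine ⟨fun n => (h.test n).comp_shear hθ hθ', ?_, ?_⟩
  · have he : ∀ f : ℝ × ℝ → ℂ, eLpNorm (fun p => f (shear θ θ' p)) 2 (guiMeasure θ) =
        ENNReal.ofReal κ ^ (1 / (2 : ENNReal)).toReal * eLpNorm f 2 (guiMeasure θ') := fun f => by
      have := (measurableEmbedding_shear hθ hθ').eLpNorm_map_measure (μ := guiMeasure θ)
        (g := f) (p := 2)
      rw [hmap, eLpNorm_smul_measure_of_ne_top (by simp), smul_eq_mul] at this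
      exact this.symm
    have := ENNReal.Tendsto.const_mul (a := ENNReal.ofReal κ ^ (1 / (2 : ENNReal)).toReal)
      h.tendsto (Or.inr (by simp))
    rw [mul_zero] at this
    exact this.congr fun n => (he fun q => w n q - g q).symm
  · obtain ⟨C, h1, h2, h3⟩ : ∃ C : ℝ, 1 ≤ C ∧
        (Real.sin θ * Real.cos θ' / (Real.cos θ * Real.sin θ')) ^ 2 ≤ C ∧
        (Real.cos θ' / Real.cos θ * ω) ^ 2 / ω' ^ 2 ≤ C :=
      ⟨_, le_max_left _ (max _ _), (le_max_left _ _).trans (le_max_right _ _),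
        (le_max_right _ _).trans (le_max_right _ _)⟩
    rw [div_le_iff₀ (by positivity)] at h3
    have hlim := h.cauchy.const_mul (C * κ)
    rw [mul_zero] at hlim
    have hb : ∀ m : ℕ × ℕ, guiForm₀ ω θ (fun p => w m.1 (shear θ θ' p) - w m.2 (shear θ θ' p)) ≤
        C * κ * guiForm₀ ω' θ' (fun p => w m.1 p - w m.2 p) := fun m =>
      guiForm₀_comp_shear_le (w := fun p => w m.1 p - w m.2 p) hθ hθ' hκ hmap h1 h2 h3 ((h.test m.1).sub (h.test m.2))
    exact squeeze_zero (fun _ => guiForm₀_nonneg _ _ _) hb hlim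

end ConicalLayer

end

/-! ### Comparison of the max-min values -/

open ConicalLayer in
theorem proposition1p3 (θ₁ θ₂ ω₁ ω₂ : ℝ)
    (hθ₁ : 0 < θ₁) (hθ : θ₁ ≤ θ₂) (hθ₂ : θ₂ < Real.pi / 2)
    (hω₁ : ω₁ ∈ Set.Ioc (0 : ℝ) (1 / 2))
    (hω₂ : ω₂ ∈ Set.Icc (Real.cos θ₂ * (Real.cos θ₁)⁻¹ * ω₁) (1 / 2)) (k : ℕ) (hk : 1 ≤ k) :
    ConicalLayer.fiberRayleigh ω₁ θ₁ k ≤ ConicalLayer.fiberRayleigh ω₂ θ₂ k := by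
  have h₁ : θ₁ ∈ Set.Ioo 0 (Real.pi / 2) := ⟨hθ₁, hθ.trans_lt hθ₂⟩
  have h₂ : θ₂ ∈ Set.Ioo 0 (Real.pi / 2) := ⟨hθ₁.trans_le hθ, hθ₂⟩
  have hc₁ := cos_pos_of_mem h₁
  have hc₂ := cos_pos_of_mem h₂
  have hs₁ := sin_pos_of_mem h₁
  have hs₂ := sin_pos_of_mem h₂
  have hlow : 0 < Real.cos θ₂ / Real.cos θ₁ * ω₁ := mul_pos (div_pos hc₂ hc₁) hω₁.1
  have hle : Real.cos θ₂ / Real.cos θ₁ * ω₁ ≤ ω₂ := by rw [div_eq_mul_inv]; exact hω₂.1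
  have hω₂0 : 0 < ω₂ := hlow.trans_le hle
  have hsq : (Real.cos θ₂ / Real.cos θ₁ * ω₁) ^ 2 ≤ 1 * ω₂ ^ 2 := by
    rw [one_mul]; gcongr
  -- This is tan θ₁ ≤ tan θ₂, read off from sin (θ₂ - θ₁) ≥ 0; together with `hsq` it allows the
  -- constant C = 1.
  have hτ : (Real.sin θ₁ * Real.cos θ₂ / (Real.cos θ₁ * Real.sin θ₂)) ^ 2 ≤ 1 := by
    have hsub := Real.sin_nonneg_of_nonneg_of_le_pi (sub_nonneg.2 hθ)
      (by linarith [Real.pi_pos] : θ₂ - θ₁ ≤ Real.pi)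
    rw [Real.sin_sub] at hsub
    refine pow_le_one₀ (by positivity) ((div_le_one (by positivity)).2 (by linarith))
  obtain ⟨κ, hκ, hmap⟩ := exists_map_shear_guiMeasure h₁ h₂
  obtain ⟨κ', hκ', hmap'⟩ := exists_map_shear_guiMeasure h₂ h₁
  have hpull := fun u : L2Gui θ₂ => memLp_comp_shear h₁ h₂ hmap (Lp.memLp u)
  have hpush := fun v : L2Gui θ₁ => memLp_comp_shear h₂ h₁ hmap' (Lp.memLp v)
  -- Push and pull are adjoint up to the Jacobian, so orthogonality to the pushed constraints yields
  -- orthogonality of the pullback to the original ones.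
  have hinner : ∀ (v : L2Gui θ₁) (u : L2Gui θ₂),
      inner ℂ v (hpull u).toLp = κ • inner ℂ (hpush v).toLp u := fun v u => by
    rw [L2.inner_def, L2.inner_def,
      ← integral_comp_shear h₁ h₂ hκ hmap fun q => inner ℂ (((hpush v).toLp _ : L2Gui θ₂) q) (u q)]
    have hqmp : ∀ᵐ p ∂guiMeasure θ₁,
        ((hpush v).toLp _ : L2Gui θ₂) (shear θ₁ θ₂ p) = v (shear θ₂ θ₁ (shear θ₁ θ₂ p)) := by
      refine ae_of_ae_map (p := fun q => ((hpush v).toLp _ : L2Gui θ₂) q = v (shear θ₂ θ₁ q))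
        (shear θ₁ θ₂).continuous.aemeasurable ?_
      rw [hmap]
      exact Measure.ae_smul_measure (hpush v).coeFn_toLp _
    refine integral_congr_ae ?_
    filter_upwards [(hpull u).coeFn_toLp, hqmp] with p hp hp'
    rw [hp, hp', shear_shear h₁ h₂]
  have hnorm : ∀ u : L2Gui θ₂, ‖(hpull u).toLp‖ ^ 2 = κ * ‖u‖ ^ 2 := fun u => by
    rw [← integral_norm_sq_eq (hpull u).coeFn_toLp,
      integral_comp_shear h₁ h₂ hκ hmap (fun q => ‖u q‖ ^ 2), smul_eq_mul,
      integral_norm_sq_eq (ae_eq_refl _)]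
  -- Constraints for angle θ₁ are pushed to θ₂, while each admissible competitor u for θ₂ is pulled
  -- back to θ₁.
  refine iSup_le fun v => le_iSup_of_le (fun i => ⟨(hpush (v i)).toLp, ?_⟩) ?_
  · obtain ⟨w, hw⟩ := mem_fiberDomain_iff.1 (v i).2
    exact mem_fiberDomain_iff.2 ⟨_, (hw.comp_shear h₂ h₁ hκ' hmap' hω₁.1.ne').congr
      (hpush (v i)).coeFn_toLp.symm⟩
  · refine le_iInf₂ fun u ⟨huD, hu0, huo⟩ => iInf₂_le_of_le (hpull u).toLp ?_ ?_
    · obtain ⟨w, hw⟩ := mem_fiberDomain_iff.1 huD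
      refine ⟨mem_fiberDomain_iff.2 ⟨_, (hw.comp_shear h₁ h₂ hκ hmap hω₂0.ne').congr
        (hpull u).coeFn_toLp.symm⟩, fun h0 => ?_, ?_⟩
      · have := hnorm u
        rw [h0, norm_zero] at this
        have hpos : 0 < κ * ‖u‖ ^ 2 := mul_pos hκ (pow_pos (norm_pos_iff.2 hu0) 2)
        linarith
      · have hsp : Submodule.span ℂ (Set.range fun i => (v i : L2Gui θ₁)) ≤
            (Submodule.span ℂ {(hpull u).toLp})ᗮ := by
          rw [Submodule.span_le]
          rintro _ ⟨i, rfl⟩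
          refine Submodule.mem_orthogonal_singleton_iff_inner_left.2 ?_
          rw [hinner, (Submodule.mem_orthogonal _ _).1 huo _ (Submodule.subset_span ⟨i, rfl⟩),
            smul_zero]
        exact (Submodule.mem_orthogonal _ _).2 fun y hy =>
          Submodule.mem_orthogonal_singleton_iff_inner_left.1 (hsp hy)
    · obtain ⟨w, hw⟩ := mem_fiberDomain_iff.1 huD
      have hw' : IsFormApprox ω₁ θ₁ _ (hpull u).toLp :=
        (hw.comp_shear h₁ h₂ hκ hmap hω₂0.ne').congr (hpull u).coeFn_toLp.symm
      have hform : fiberForm ω₁ θ₁ (hpull u).toLp ≤ 1 * κ * fiberForm ω₂ θ₂ u :=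
        le_of_tendsto_of_tendsto' hw'.tendsto_guiForm₀ (hw.tendsto_guiForm₀.const_mul (1 * κ))
          fun n => guiForm₀_comp_shear_le h₁ h₂ hκ hmap le_rfl hτ hsq (hw.test n)
      rw [one_mul] at hform
      -- The factor κ appears in both the form bound and the squared norm, and cancels.
      rw [EReal.coe_le_coe_iff, hnorm, ← mul_div_mul_left (fiberForm ω₂ θ₂ u) _ hκ.ne']
      gcongr
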